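/- Let $d\ge 1$, let $R\subset\mathbb R^d$ be a reduced root system (a finite set of nonzero vectors, not necessarily crystallographic or spanning, with $r_\alpha R=R$ and $R\cap\mathbb R\alpha=\{\pm\alpha\}$ for all $\alpha\in R$, where $r_\alpha$ is the orthogonal reflection in $\alpha^\perp$), let $R_+\subset R$ be a positive system, i.e. $R_+=\{\alpha\in R:\langle\alpha,\beta\rangle>0\}$ for some $\beta$ with $\langle\alpha,\beta\rangle\neq0$ for all $\alpha\in R$, and let $\kappa:R\to[0,\infty)$ be invariant under the group generated by the reflections $r_\alpha$, $\alpha\in R$. Put $$\lambda_\kappa=\frac d2-1+\sum_{\alpha\in R_+}\kappa_\alpha,\qquad h_\kappa(x)=\prod_{\alpha\in R_+}|\langle\alpha,x\rangle|^{\kappa_\alpha},\qquad \omega_{\kappa,d}=\int_{S^{d-1}}h_\kappa^2\,d\sigma,$$ where $\sigma$ is the surface measure on the unit sphere $S^{d-1}$ (with $0^0=1$ in $h_\kappa$; counting measure if $d=1$). For $\xi\in\mathbb R^d$ the Dunkl operator is $$\mathscr D_\xi f(x)=\partial_\xi f(x)+\sum_{\alpha\in R_+}\kappa_\alpha\langle\alpha,\xi\rangle\frac{f(x)-f(r_\alpha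 x)}{\langle\alpha,x\rangle},$$ where on the hyperplane $\langle\alpha,x\rangle=0$ the quotient is understood as its limit $\frac{2}{\|\alpha\|^2}\,\partial_\alpha f(x)$. Let $\mathscr D_j=\mathscr D_{e_j}$ for the standard basis $e_1,\dots,e_d$, $\mathscr D=(\mathscr D_1,\dots,\mathscr D_d)$ (these operators commute on smooth functions) and $\Delta_\kappa=\sum_{j=1}^d\mathscr D_j^2$. Let $(a)_0=1$ and $(a)_n=a(a+1)\cdots(a+n-1)$ for $n\ge1$. Let $q$ be a homogeneous polynomial of degree $m\ge0$ on $\mathbb R^d$ with real coefficients and $\Delta_\kappa q=0$. (i) If $f$ is a real-valued smooth function on a neighbourhood of $0\in\mathbb R^d$, then for every integer $N\ge0$ $$\frac1{\omega_{\kappa,d}}\int_{S^{d-1}}q(y)f(ry)h_\kappa^2(y)\,d\sigma(y)=\sum_{n=0}^N\frac{(q(\mathscr D)\Delta_\kappa^nf)(0)}{n!\,(\lambda_\kappa+1)_{m+n}}\Bigl(\frac r2\Bigr)^{m+2n}+o(r^{m+2N})\qquad(r\to0^+).$$ (ii) If $f$ is a real-valued function that is real analytic in the open unit ball around $0\in\mathbb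 R^d$, then there is $\rho\in(0,1)$ such that for all $r$ with $0<r<\rho$ the following series converges and $$\frac1{\omega_{\kappa,d}}\int_{S^{d-1}}q(y)f(ry)h_\kappa^2(y)\,d\sigma(y)=\sum_{n=0}^\infty\frac{(q(\mathscr D)\Delta_\kappa^nf)(0)}{n!\,(\lambda_\kappa+1)_{m+n}}\Bigl(\frac r2\Bigr)^{m+2n}.$$ -/

import Mathlib

open Asymptotics
open scoped ContDiff Topology

namespace Dunkl

noncomputable section

/-- A reduced (not necessarily crystallographic) root system in Euclidean space: a finite set of
nonzero vectors, stable under the reflections in the hyperplanes orthogonal to its members, in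
which the only multiples of a root `α` are `α` and `-α`. It need not span. -/
structure IsReducedRootSystem {d : ℕ} (R : Finset (EuclideanSpace ℝ (Fin d))) : Prop where
  ne_zero : ∀ α ∈ R, α ≠ 0
  reflection_mem : ∀ α ∈ R, ∀ β ∈ R, (ℝ ∙ α)ᗮ.reflection β ∈ R
  reduced : ∀ α ∈ R, ∀ c : ℝ, c • α ∈ R → c = 1 ∨ c = -1

/-- `P` is a positive system of `R`: the roots on one side of a hyperplane through the origin
that contains no root. -/
def IsPositiveSystem {d : ℕ} (R P : Finset (EuclideanSpace ℝ (Fin d))) : Prop :=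
  ∃ β : EuclideanSpace ℝ (Fin d), (∀ α ∈ R, inner ℝ α β ≠ 0) ∧
    ∀ α, α ∈ P ↔ α ∈ R ∧ 0 < inner ℝ α β

/-- The reflection group generated by the reflections in the hyperplanes orthogonal to the
elements of `R`. -/
def reflectionGroup {d : ℕ} (R : Finset (EuclideanSpace ℝ (Fin d))) :
    Subgroup (EuclideanSpace ℝ (Fin d) ≃ₗᵢ[ℝ] EuclideanSpace ℝ (Fin d)) :=
  Subgroup.closure {g | ∃ α ∈ R, g = (ℝ ∙ α)ᗮ.reflection}

/-- `κ` (only its values on `R` matter) is a non-negative multiplicity function on `R`: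
it is constant on the orbits of the reflection group. -/
structure IsMultiplicity {d : ℕ} (R : Finset (EuclideanSpace ℝ (Fin d)))
    (κ : EuclideanSpace ℝ (Fin d) → ℝ) : Prop where
  nonneg : ∀ α ∈ R, 0 ≤ κ α
  invariant : ∀ g ∈ reflectionGroup R, ∀ α ∈ R, κ (g α) = κ α

/-- The quotient `(f x - f (r_α x)) / ⟨α, x⟩`, extended to the hyperplane `⟨α, x⟩ = 0` by its
limit `(2 / ‖α‖²) ∂_α f x` (for `f` continuously differentiable near `x`). -/
def diffQuot {d : ℕ} (α : EuclideanSpace ℝ (Fin d)) (f : EuclideanSpace ℝ (Fin d) → ℝ)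
    (x : EuclideanSpace ℝ (Fin d)) : ℝ :=
  if inner ℝ α x = 0 then 2 / ‖α‖ ^ 2 * fderiv ℝ f x α
  else (f x - f ((ℝ ∙ α)ᗮ.reflection x)) / inner ℝ α x

/-- The Dunkl operator `𝒟_ξ` for the positive system `P` and the multiplicity function `κ`. -/
def dunklOp {d : ℕ} (P : Finset (EuclideanSpace ℝ (Fin d))) (κ : EuclideanSpace ℝ (Fin d) → ℝ)
    (ξ : EuclideanSpace ℝ (Fin d)) (f : EuclideanSpace ℝ (Fin d) → ℝ) :
    EuclideanSpace ℝ (Fin d) → ℝ :=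
  fun x => fderiv ℝ f x ξ + ∑ α ∈ P, κ α * inner ℝ α ξ * diffQuot α f x

/-- The Dunkl operator `𝒟_j` in the direction of the `j`-th standard basis vector. -/
def dunklPartial {d : ℕ} (P : Finset (EuclideanSpace ℝ (Fin d)))
    (κ : EuclideanSpace ℝ (Fin d) → ℝ) (j : Fin d) (f : EuclideanSpace ℝ (Fin d) → ℝ) :
    EuclideanSpace ℝ (Fin d) → ℝ :=
  dunklOp P κ (EuclideanSpace.single j 1) f

/-- The Dunkl Laplacian `Δ_κ = ∑ j, 𝒟_j²`. -/
def dunklLaplacian {d : ℕ} (P : Finset (EuclideanSpace ℝ (Fin d)))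
    (κ : EuclideanSpace ℝ (Fin d) → ℝ) (f : EuclideanSpace ℝ (Fin d) → ℝ) :
    EuclideanSpace ℝ (Fin d) → ℝ :=
  fun x => ∑ j, dunklPartial P κ j (dunklPartial P κ j f) x

/-- `𝒟₁^(s 1) (𝒟₂^(s 2) (⋯ (𝒟_d^(s d) f)))`. The Dunkl operators commute on smooth functions,
so the order chosen here is immaterial. -/
def dunklMonomial {d : ℕ} (P : Finset (EuclideanSpace ℝ (Fin d)))
    (κ : EuclideanSpace ℝ (Fin d) → ℝ) (s : Fin d →₀ ℕ) (f : EuclideanSpace ℝ (Fin d) → ℝ) :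
    EuclideanSpace ℝ (Fin d) → ℝ :=
  (List.finRange d).foldr (fun j g => (dunklPartial P κ j)^[s j] g) f

/-- `q(𝒟) f`, the polynomial `q` evaluated at `𝒟 = (𝒟₁, …, 𝒟_d)` and applied to `f`. -/
def dunklPoly {d : ℕ} (P : Finset (EuclideanSpace ℝ (Fin d)))
    (κ : EuclideanSpace ℝ (Fin d) → ℝ) (q : MvPolynomial (Fin d) ℝ)
    (f : EuclideanSpace ℝ (Fin d) → ℝ) : EuclideanSpace ℝ (Fin d) → ℝ :=
  fun x => ∑ s ∈ q.support, q.coeff s * dunklMonomial P κ s f x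

/-- The function on Euclidean space given by a polynomial in the coordinates. -/
def polyFun {d : ℕ} (q : MvPolynomial (Fin d) ℝ) : EuclideanSpace ℝ (Fin d) → ℝ :=
  fun x => MvPolynomial.eval (fun j => x j) q

/-- The homogeneous Dunkl harmonic polynomials of degree `m`. -/
def IsHomogeneousHarmonic {d : ℕ} (P : Finset (EuclideanSpace ℝ (Fin d)))
    (κ : EuclideanSpace ℝ (Fin d) → ℝ) (m : ℕ) (q : MvPolynomial (Fin d) ℝ) : Prop :=
  q.IsHomogeneous m ∧ ∀ x, dunklLaplacian P κ (polyFun q) x = 0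

/-- `λ_κ = d / 2 - 1 + ∑ α ∈ R₊, κ_α`. -/
def lam {d : ℕ} (P : Finset (EuclideanSpace ℝ (Fin d))) (κ : EuclideanSpace ℝ (Fin d) → ℝ) : ℝ :=
  (d : ℝ) / 2 - 1 + ∑ α ∈ P, κ α

/-- The weight `h_κ(x) = ∏ α ∈ R₊, |⟨α, x⟩| ^ κ_α`. -/
def weight {d : ℕ} (P : Finset (EuclideanSpace ℝ (Fin d))) (κ : EuclideanSpace ℝ (Fin d) → ℝ)
    (x : EuclideanSpace ℝ (Fin d)) : ℝ :=
  ∏ α ∈ P, |inner ℝ α x| ^ κ α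

/-- The integral of `F` over the unit sphere with respect to surface measure. -/
def sphereIntegral {d : ℕ} (F : EuclideanSpace ℝ (Fin d) → ℝ) : ℝ :=
  ∫ y : Metric.sphere (0 : EuclideanSpace ℝ (Fin d)) 1, F y
    ∂((MeasureTheory.volume : MeasureTheory.Measure (EuclideanSpace ℝ (Fin d))).toSphere)

/-- `ω_{κ,d}`, the integral of `h_κ²` over the unit sphere. -/
def omega {d : ℕ} (P : Finset (EuclideanSpace ℝ (Fin d)))
    (κ : EuclideanSpace ℝ (Fin d) → ℝ) : ℝ :=
  sphereIntegral fun y => weight P κ y ^ 2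

/-- `ω_{κ,d}⁻¹ ∫ q(y) f(r y) h_κ(y)² dσ(y)`, the integral being over the unit sphere. -/
def sphericalMean {d : ℕ} (P : Finset (EuclideanSpace ℝ (Fin d)))
    (κ : EuclideanSpace ℝ (Fin d) → ℝ) (q : MvPolynomial (Fin d) ℝ)
    (f : EuclideanSpace ℝ (Fin d) → ℝ) (r : ℝ) : ℝ :=
  1 / omega P κ * sphereIntegral fun y => polyFun q y * f (r • y) * weight P κ y ^ 2

/-- The term `(q(𝒟) Δ_κ^n f)(0) / (n! (λ_κ + 1)_{m+n}) * (r / 2)^(m + 2n)`. -/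
def pizzettiTerm {d : ℕ} (P : Finset (EuclideanSpace ℝ (Fin d)))
    (κ : EuclideanSpace ℝ (Fin d) → ℝ) (m : ℕ) (q : MvPolynomial (Fin d) ℝ)
    (f : EuclideanSpace ℝ (Fin d) → ℝ) (r : ℝ) (n : ℕ) : ℝ :=
  dunklPoly P κ q ((dunklLaplacian P κ)^[n] f) 0 /
    ((n.factorial : ℝ) * (ascPochhammer ℝ (m + n)).eval (lam P κ + 1)) * (r / 2) ^ (m + 2 * n)

end

end Dunkl

namespace Dunkl

noncomputable section

local notation:max "𝔯" α:max => Submodule.reflection (Submodule.span ℝ {α})ᗮ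

section Reflection

variable {d : ℕ}

lemma reflection_eq (α x : EuclideanSpace ℝ (Fin d)) :
    𝔯 α x = x - (2 * inner ℝ α x / ‖α‖ ^ 2) • α := by
  rw [Submodule.reflection_orthogonal_apply, Submodule.reflection_singleton_apply, neg_sub,
    ← Nat.cast_smul_eq_nsmul ℝ, smul_smul, mul_div_assoc]
  norm_num

lemma inner_reflection {α : EuclideanSpace ℝ (Fin d)} (hα : α ≠ 0)
    (x : EuclideanSpace ℝ (Fin d)) : inner ℝ α (𝔯 α x) = - inner ℝ α x := by
  have : ‖α‖ ≠ 0 := norm_ne_zero_iff.2 hα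
  rw [reflection_eq, inner_sub_right, inner_smul_right, real_inner_self_eq_norm_sq]
  field_simp
  ring

lemma reflection_of_inner_eq_zero {α x : EuclideanSpace ℝ (Fin d)} (h : inner ℝ α x = 0) :
    𝔯 α x = x := by
  simp [reflection_eq, h]

lemma map_reflection (g : EuclideanSpace ℝ (Fin d) ≃ₗᵢ[ℝ] EuclideanSpace ℝ (Fin d))
    (α x : EuclideanSpace ℝ (Fin d)) : g (𝔯 α x) = 𝔯 (g α) (g x) := by
  simp [reflection_eq]

/-- A reflection in a positive root permutes the positive system up to signs. -/
@[to_additive]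
lemma prod_positive_reflection {M : Type*} [CommMonoid M] {R P : Finset (EuclideanSpace ℝ (Fin d))}
    (hR : IsReducedRootSystem R) (hP : IsPositiveSystem R P) {β : EuclideanSpace ℝ (Fin d)}
    (hβ : β ∈ P) (F : EuclideanSpace ℝ (Fin d) → M) (hF : ∀ α ∈ R, F (-α) = F α) :
    ∏ α ∈ P, F (𝔯 β α) = ∏ α ∈ P, F α := by
  obtain ⟨b, hb, hPb⟩ := hP
  have hβR : β ∈ R := ((hPb β).1 hβ).1
  have hneg : ∀ α ∈ R, -α ∈ R := fun α hα => by
    have := hR.reflection_mem α hα α hα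
    rwa [Submodule.reflection_orthogonalComplement_singleton_eq_neg] at this
  classical
  let s : EuclideanSpace ℝ (Fin d) → EuclideanSpace ℝ (Fin d) := fun α =>
    if 0 < inner ℝ (𝔯 β α) b then 𝔯 β α else - 𝔯 β α
  have hs : ∀ α ∈ P, s α ∈ P := by
    intro α hα
    have hαR := hR.reflection_mem β hβR α ((hPb α).1 hα).1
    by_cases h : 0 < inner ℝ (𝔯 β α) b
    · simp only [s, if_pos h]
      exact (hPb _).2 ⟨hαR, h⟩
    · simp only [s, if_neg h]
      refine (hPb _).2 ⟨hneg _ hαR, ?_⟩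
      rw [inner_neg_left]
      exact neg_pos.2 (lt_of_le_of_ne (not_lt.1 h) (hb _ hαR))
  have hss : ∀ α ∈ P, s (s α) = α := by
    intro α hα
    have h0 : 0 < inner ℝ α b := ((hPb α).1 hα).2
    by_cases h : 0 < inner ℝ (𝔯 β α) b
    · simp [s, if_pos h, h0]
    · have : ¬ 0 < inner ℝ (-α) b := by
        rw [inner_neg_left]; linarith
      simp [s, if_neg h, h0.le]
  refine Finset.prod_bij' (fun α _ => s α) (fun α _ => s α) hs hs hss hss ?_
  intro α hα
  have hαR := hR.reflection_mem β hβR α ((hPb α).1 hα).1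
  by_cases h : 0 < inner ℝ (𝔯 β α) b
  · simp only [s, if_pos h]
  · simp only [s, if_neg h, hF _ hαR]

end Reflection

section DiffQuot

variable {d : ℕ} {α : EuclideanSpace ℝ (Fin d)} {f g : EuclideanSpace ℝ (Fin d) → ℝ}
  {x : EuclideanSpace ℝ (Fin d)}

lemma inner_mul_diffQuot (α : EuclideanSpace ℝ (Fin d)) (f : EuclideanSpace ℝ (Fin d) → ℝ)
    (x : EuclideanSpace ℝ (Fin d)) : inner ℝ α x * diffQuot α f x = f x - f (𝔯 α x) := by
  by_cases h : inner ℝ α x = 0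
  · simp [h, reflection_of_inner_eq_zero h]
  · rw [diffQuot, if_neg h, mul_div_cancel₀ _ h]

lemma diffQuot_reflection (hα : α ≠ 0) : diffQuot α f (𝔯 α x) = diffQuot α f x := by
  by_cases h : inner ℝ α x = 0
  · rw [reflection_of_inner_eq_zero h]
  · rw [diffQuot, diffQuot, if_neg h, inner_reflection hα, if_neg (neg_ne_zero.2 h),
      Submodule.reflection_reflection, div_neg, ← neg_div, neg_sub]

lemma diffQuot_neg (α : EuclideanSpace ℝ (Fin d)) (f : EuclideanSpace ℝ (Fin d) → ℝ)
    (x : EuclideanSpace ℝ (Fin d)) : diffQuot (-α) f x = - diffQuot α f x := by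
  by_cases h : inner ℝ α x = 0
  · simp [diffQuot, h]
  · have : 𝔯 (-α) x = 𝔯 α x := by
      simp [reflection_eq, neg_div, sub_eq_add_neg]
    rw [diffQuot, diffQuot, if_neg h, inner_neg_left, if_neg (neg_ne_zero.2 h), this, div_neg]

lemma diffQuot_mul (hf : DifferentiableAt ℝ f x) (hg : DifferentiableAt ℝ g x) :
    diffQuot α (fun y => f y * g y) x = diffQuot α f x * g x + f x * diffQuot α g x
      - inner ℝ α x * (diffQuot α f x * diffQuot α g x) := by
  by_cases h : inner ℝ α x = 0
  · simp only [diffQuot, fderiv_fun_mul hf hg, h]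
    simp
    ring
  · simp only [diffQuot, if_neg h]
    field_simp
    ring

lemma diffQuot_add (hf : DifferentiableAt ℝ f x) (hg : DifferentiableAt ℝ g x) :
    diffQuot α (fun y => f y + g y) x = diffQuot α f x + diffQuot α g x := by
  by_cases h : inner ℝ α x = 0
  · simp only [diffQuot, if_pos h, fderiv_fun_add hf hg]
    simp
    ring
  · simp only [diffQuot, if_neg h]
    ring

@[simp] lemma diffQuot_const (α : EuclideanSpace ℝ (Fin d)) (c : ℝ)
    (x : EuclideanSpace ℝ (Fin d)) : diffQuot α (fun _ => c) x = 0 := by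
  simp [diffQuot]

lemma diffQuot_const_mul (hf : DifferentiableAt ℝ f x) (c : ℝ) :
    diffQuot α (fun y => c * f y) x = c * diffQuot α f x := by
  rw [diffQuot_mul (differentiableAt_const c) hf]
  simp

lemma diffQuot_coord (hα : α ≠ 0) (j : Fin d) :
    diffQuot α (fun y => y j) x = 2 / ‖α‖ ^ 2 * α j := by
  have hn : ‖α‖ ≠ 0 := norm_ne_zero_iff.2 hα
  by_cases h : inner ℝ α x = 0
  · have h1 : HasFDerivAt (fun y : EuclideanSpace ℝ (Fin d) => y j)
        (EuclideanSpace.proj j : EuclideanSpace ℝ (Fin d) →L[ℝ] ℝ) x :=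
      (EuclideanSpace.proj j : EuclideanSpace ℝ (Fin d) →L[ℝ] ℝ).hasFDerivAt
    simp [diffQuot, if_pos h, h1.fderiv]
  · rw [diffQuot, if_neg h, reflection_eq]
    simp
    field_simp

lemma diffQuot_coord_mul (hα : α ≠ 0) (j : Fin d) (hf : DifferentiableAt ℝ f x) :
    diffQuot α (fun y => y j * f y) x
      = x j * diffQuot α f x + 2 / ‖α‖ ^ 2 * α j * f (𝔯 α x) := by
  have h1 : DifferentiableAt ℝ (fun y : EuclideanSpace ℝ (Fin d) => y j) x :=
    (EuclideanSpace.proj j : EuclideanSpace ℝ (Fin d) →L[ℝ] ℝ).differentiableAt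
  rw [diffQuot_mul h1 hf, diffQuot_coord hα]
  linear_combination (- (2 / ‖α‖ ^ 2 * α j)) * inner_mul_diffQuot α f x

lemma diffQuot_comp (g : EuclideanSpace ℝ (Fin d) ≃ₗᵢ[ℝ] EuclideanSpace ℝ (Fin d)) :
    diffQuot α (fun y => f (g y)) x = diffQuot (g α) f (g x) := by
  have h1 : fderiv ℝ (fun y => f (g y)) x α = fderiv ℝ f (g x) (g α) := by
    have := g.toContinuousLinearEquiv.comp_right_fderiv (f := f) (x := x)
    simp only [Function.comp_def] at this
    erw [this]
    rfl
  rw [diffQuot, diffQuot, h1, g.inner_map_map, g.norm_map, map_reflection]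

end DiffQuot

section DunklOp

variable {d : ℕ} {P : Finset (EuclideanSpace ℝ (Fin d))} {κ : EuclideanSpace ℝ (Fin d) → ℝ}
  {ξ : EuclideanSpace ℝ (Fin d)} {f g : EuclideanSpace ℝ (Fin d) → ℝ}
  {x : EuclideanSpace ℝ (Fin d)}

lemma dunklOp_add_fun (hf : DifferentiableAt ℝ f x) (hg : DifferentiableAt ℝ g x) :
    dunklOp P κ ξ (fun y => f y + g y) x = dunklOp P κ ξ f x + dunklOp P κ ξ g x := by
  simp only [dunklOp, fderiv_fun_add hf hg, diffQuot_add hf hg, mul_add, Finset.sum_add_distrib,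
    add_apply]
  ring

lemma dunklOp_const (c : ℝ) : dunklOp P κ ξ (fun _ => c) x = 0 := by
  simp [dunklOp]

lemma dunklOp_const_mul (hf : DifferentiableAt ℝ f x) (c : ℝ) :
    dunklOp P κ ξ (fun y => c * f y) x = c * dunklOp P κ ξ f x := by
  simp only [dunklOp, fderiv_const_mul hf, diffQuot_const_mul hf, mul_add, Finset.mul_sum,
    smul_apply, smul_eq_mul]
  congr 1
  exact Finset.sum_congr rfl fun α _ => by ring

lemma dunklOp_add (ξ η : EuclideanSpace ℝ (Fin d)) :
    dunklOp P κ (ξ + η) f x = dunklOp P κ ξ f x + dunklOp P κ η f x := by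
  simp only [dunklOp, inner_add_right, map_add, mul_add, add_mul, Finset.sum_add_distrib]
  ring

lemma dunklOp_smul (c : ℝ) (ξ : EuclideanSpace ℝ (Fin d)) :
    dunklOp P κ (c • ξ) f x = c * dunklOp P κ ξ f x := by
  simp only [dunklOp, inner_smul_right, map_smul, mul_add, Finset.mul_sum, smul_eq_mul]
  congr 1
  exact Finset.sum_congr rfl fun α _ => by ring

lemma dunklOp_coord_mul (hP : ∀ α ∈ P, α ≠ 0) (j : Fin d) (hf : DifferentiableAt ℝ f x) :
    dunklOp P κ ξ (fun y => y j * f y) x = x j * dunklOp P κ ξ f x + ξ j * f x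
      + ∑ α ∈ P, 2 * κ α * inner ℝ α ξ / ‖α‖ ^ 2 * α j * f (𝔯 α x) := by
  have h1 : HasFDerivAt (fun y : EuclideanSpace ℝ (Fin d) => y j)
      (EuclideanSpace.proj j : EuclideanSpace ℝ (Fin d) →L[ℝ] ℝ) x :=
    (EuclideanSpace.proj j : EuclideanSpace ℝ (Fin d) →L[ℝ] ℝ).hasFDerivAt
  have h2 : ∑ α ∈ P, κ α * inner ℝ α ξ * diffQuot α (fun y => y j * f y) x
      = ∑ α ∈ P, κ α * inner ℝ α ξ * (x j * diffQuot α f x + 2 / ‖α‖ ^ 2 * α j * f (𝔯 α x)) :=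
    Finset.sum_congr rfl fun α hα => by rw [diffQuot_coord_mul (hP α hα) j hf]
  rw [dunklOp, h2, fderiv_fun_mul h1.differentiableAt hf, h1.fderiv, dunklOp, mul_add,
    Finset.mul_sum]
  simp only [add_apply, smul_apply, smul_eq_mul,
    PiLp.proj_apply, mul_add, Finset.sum_add_distrib]
  have h3 : ∀ a b c e a' c' : ℝ, a = a' → c = c' →
      x j * b + f x * e + (a + c) = x j * b + a' + e * f x + c' := by
    rintro a b c e _ _ rfl rfl; ring
  apply h3 <;> exact Finset.sum_congr rfl fun α _ => by ring

lemma IsMultiplicity.reflection {R : Finset (EuclideanSpace ℝ (Fin d))}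
    (hκ : IsMultiplicity R κ) {γ α : EuclideanSpace ℝ (Fin d)} (hγ : γ ∈ R) (hα : α ∈ R) :
    κ (𝔯 γ α) = κ α :=
  hκ.invariant _ (Subgroup.subset_closure ⟨γ, hγ, rfl⟩) α hα

lemma IsMultiplicity.neg {R : Finset (EuclideanSpace ℝ (Fin d))}
    (hκ : IsMultiplicity R κ) {α : EuclideanSpace ℝ (Fin d)} (hα : α ∈ R) : κ (-α) = κ α := by
  have := hκ.reflection hα hα
  rwa [Submodule.reflection_orthogonalComplement_singleton_eq_neg] at this

lemma dunklOp_comp_reflection {R : Finset (EuclideanSpace ℝ (Fin d))}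
    (hR : IsReducedRootSystem R) (hP : IsPositiveSystem R P) (hκ : IsMultiplicity R κ)
    {β : EuclideanSpace ℝ (Fin d)} (hβ : β ∈ P) :
    dunklOp P κ ξ (fun y => f (𝔯 β y)) x = dunklOp P κ (𝔯 β ξ) f (𝔯 β x) := by
  have hPR : ∀ α ∈ P, α ∈ R := fun α hα => by
    obtain ⟨b, -, hb⟩ := hP
    exact ((hb α).1 hα).1
  have hκr := fun γ hγ α hα => hκ.reflection (γ := γ) hγ (α := α) hα
  have h1 : fderiv ℝ (fun y => f (𝔯 β y)) x ξ = fderiv ℝ f (𝔯 β x) (𝔯 β ξ) := by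
    have := (𝔯 β).toContinuousLinearEquiv.comp_right_fderiv (f := f) (x := x)
    simp only [Function.comp_def] at this
    erw [this]
    rfl
  rw [dunklOp, dunklOp, h1, ← sum_positive_reflection hR hP hβ
    (fun α => κ α * inner ℝ α (𝔯 β ξ) * diffQuot α f (𝔯 β x))]
  · congr 1
    refine Finset.sum_congr rfl fun α hα => ?_
    rw [diffQuot_comp, LinearIsometryEquiv.inner_map_map, hκr β (hPR β hβ) α (hPR α hα)]
  · intro α hα
    rw [hκ.neg hα, inner_neg_left, diffQuot_neg]
    ring

end DunklOp

open MvPolynomial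

section PolyFun

variable {d : ℕ}

@[simp] lemma polyFun_add (p q : MvPolynomial (Fin d) ℝ) (x : EuclideanSpace ℝ (Fin d)) :
    polyFun (p + q) x = polyFun p x + polyFun q x := map_add _ _ _

@[simp] lemma polyFun_sub (p q : MvPolynomial (Fin d) ℝ) (x : EuclideanSpace ℝ (Fin d)) :
    polyFun (p - q) x = polyFun p x - polyFun q x := map_sub _ _ _

@[simp] lemma polyFun_mul (p q : MvPolynomial (Fin d) ℝ) (x : EuclideanSpace ℝ (Fin d)) :
    polyFun (p * q) x = polyFun p x * polyFun q x := map_mul _ _ _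

@[simp] lemma polyFun_zero (x : EuclideanSpace ℝ (Fin d)) :
    polyFun (0 : MvPolynomial (Fin d) ℝ) x = 0 := map_zero _

@[simp] lemma polyFun_C (c : ℝ) (x : EuclideanSpace ℝ (Fin d)) :
    polyFun (C c) x = c := eval_C _

@[simp] lemma polyFun_one (x : EuclideanSpace ℝ (Fin d)) :
    polyFun (1 : MvPolynomial (Fin d) ℝ) x = 1 := map_one _

@[simp] lemma polyFun_X (j : Fin d) (x : EuclideanSpace ℝ (Fin d)) :
    polyFun (X j) x = x j := eval_X _

@[simp] lemma polyFun_smul (c : ℝ) (p : MvPolynomial (Fin d) ℝ) (x : EuclideanSpace ℝ (Fin d)) :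
    polyFun (c • p) x = c * polyFun p x := by simp [polyFun, smul_eval]

@[simp] lemma polyFun_sum {ι : Type*} (s : Finset ι) (p : ι → MvPolynomial (Fin d) ℝ)
    (x : EuclideanSpace ℝ (Fin d)) :
    polyFun (∑ i ∈ s, p i) x = ∑ i ∈ s, polyFun (p i) x := map_sum _ _ _

lemma polyFun_injective : Function.Injective
    (polyFun : MvPolynomial (Fin d) ℝ → EuclideanSpace ℝ (Fin d) → ℝ) := by
  intro p q h
  refine MvPolynomial.funext fun v => ?_
  exact congrFun h (WithLp.toLp 2 v)

lemma contDiff_coord (j : Fin d) : ContDiff ℝ ∞ (fun y : EuclideanSpace ℝ (Fin d) => y j) :=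
  (EuclideanSpace.proj j : EuclideanSpace ℝ (Fin d) →L[ℝ] ℝ).contDiff

lemma contDiff_polyFun (p : MvPolynomial (Fin d) ℝ) : ContDiff ℝ ∞ (polyFun p) := by
  induction p using MvPolynomial.induction_on with
  | C a =>
    have : polyFun (C a) = fun _ : EuclideanSpace ℝ (Fin d) => a := by ext x; simp
    rw [this]
    exact contDiff_const
  | add p q hp hq =>
    have : polyFun (p + q) = fun x => polyFun p x + polyFun q x := by ext x; simp
    rw [this]
    exact hp.add hq
  | mul_X p j hp =>
    have : polyFun (p * X j) = fun x => polyFun p x * x j := by ext x; simp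
    rw [this]
    exact hp.mul (contDiff_coord j)

lemma differentiableAt_polyFun (p : MvPolynomial (Fin d) ℝ) (x : EuclideanSpace ℝ (Fin d)) :
    DifferentiableAt ℝ (polyFun p) x :=
  ((contDiff_polyFun p).differentiable (by simp)).differentiableAt

lemma fderiv_polyFun (p : MvPolynomial (Fin d) ℝ) (x ξ : EuclideanSpace ℝ (Fin d)) :
    fderiv ℝ (polyFun p) x ξ = polyFun (∑ j, ξ j • pderiv j p) x := by
  induction p using MvPolynomial.induction_on with
  | C a =>
    have : polyFun (C a) = fun _ : EuclideanSpace ℝ (Fin d) => a := by ext x; simp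
    simp [this]
  | add p q hp hq =>
    have : polyFun (p + q) = fun x => polyFun p x + polyFun q x := by ext x; simp
    rw [this, fderiv_fun_add (differentiableAt_polyFun p x) (differentiableAt_polyFun q x),
      add_apply, hp, hq]
    simp [Finset.sum_add_distrib]
  | mul_X p j hp =>
    have : polyFun (p * X j) = fun x => polyFun p x * x j := by ext x; simp
    have h1 : HasFDerivAt (fun y : EuclideanSpace ℝ (Fin d) => y j)
        (EuclideanSpace.proj j : EuclideanSpace ℝ (Fin d) →L[ℝ] ℝ) x :=
      (EuclideanSpace.proj j : EuclideanSpace ℝ (Fin d) →L[ℝ] ℝ).hasFDerivAt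
    rw [this, fderiv_fun_mul (differentiableAt_polyFun p x) h1.differentiableAt, h1.fderiv,
      add_apply, smul_apply, smul_apply, hp]
    have h2 (i : Fin d) : polyFun (pderiv i (p * X j)) x
        = polyFun (pderiv i p) x * x j + polyFun p x * (if i = j then 1 else 0) := by
      rw [Derivation.leibniz, pderiv_X]
      by_cases h : i = j
      · subst h; simp; ring
      · simp [h, mul_comm, Ne.symm h]
    simp only [polyFun_sum, polyFun_smul, h2, mul_add, Finset.sum_add_distrib, PiLp.proj_apply,
      smul_eq_mul, mul_ite, mul_one, mul_zero, Finset.sum_ite_eq', Finset.mem_univ, if_true,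
      Finset.mul_sum]
    rw [add_comm]
    congr 1
    · exact Finset.sum_congr rfl fun i _ => by ring
    · ring

/-- The action of the reflection in `αᗮ` on polynomials. -/
def reflPoly (α : EuclideanSpace ℝ (Fin d)) :
    MvPolynomial (Fin d) ℝ →ₐ[ℝ] MvPolynomial (Fin d) ℝ :=
  aeval fun j => X j - (2 * α j / ‖α‖ ^ 2) • ∑ i, α i • X i

lemma polyFun_reflPoly (α : EuclideanSpace ℝ (Fin d)) (p : MvPolynomial (Fin d) ℝ)
    (x : EuclideanSpace ℝ (Fin d)) : polyFun (reflPoly α p) x = polyFun p (𝔯 α x) := by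
  induction p using MvPolynomial.induction_on with
  | C a => simp [reflPoly]
  | add p q hp hq => simp [hp, hq]
  | mul_X p j hp =>
    rw [map_mul, polyFun_mul, polyFun_mul, hp, reflPoly, aeval_X, reflection_eq]
    simp only [polyFun_sub, polyFun_X, polyFun_smul, polyFun_sum, PiLp.sub_apply, PiLp.smul_apply,
      smul_eq_mul, PiLp.inner_apply, RCLike.inner_apply, conj_trivial]
    have : ∑ i, x i * α i = ∑ i, α i * x i := Finset.sum_congr rfl fun i _ => mul_comm _ _
    rw [this]
    ring

lemma isHomogeneous_reflPoly (α : EuclideanSpace ℝ (Fin d)) {p : MvPolynomial (Fin d) ℝ} {k : ℕ}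
    (hp : p.IsHomogeneous k) : (reflPoly α p).IsHomogeneous k := by
  have := hp.aeval (n := 1) (fun j : Fin d => X j - (2 * α j / ‖α‖ ^ 2) • ∑ i, α i • X i)
    (fun j => (isHomogeneous_X ℝ j).sub (by
      rw [smul_eq_C_mul]
      refine IsHomogeneous.C_mul (IsHomogeneous.sum _ _ _ fun i _ => ?_) _
      rw [smul_eq_C_mul]
      exact (isHomogeneous_X ℝ i).C_mul _))
  simpa [reflPoly] using this

lemma exists_polyFun_eq_diffQuot (α : EuclideanSpace ℝ (Fin d)) (p : MvPolynomial (Fin d) ℝ) :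
    ∃ p', polyFun p' = diffQuot α (polyFun p) := by
  by_cases hα : α = 0
  · exact ⟨0, by ext x; simp [diffQuot, hα]⟩
  induction p using MvPolynomial.induction_on with
  | C a =>
    refine ⟨0, ?_⟩
    have : polyFun (C a) = fun _ : EuclideanSpace ℝ (Fin d) => a := by ext x; simp
    ext x
    simp [this]
  | add p q hp hq =>
    obtain ⟨p', hp'⟩ := hp
    obtain ⟨q', hq'⟩ := hq
    refine ⟨p' + q', ?_⟩
    have : polyFun (p + q) = fun x => polyFun p x + polyFun q x := by ext x; simp
    ext x
    rw [this, diffQuot_add (differentiableAt_polyFun p x) (differentiableAt_polyFun q x),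
      polyFun_add, hp', hq']
  | mul_X p j hp =>
    obtain ⟨p', hp'⟩ := hp
    refine ⟨X j * p' + (2 / ‖α‖ ^ 2 * α j) • reflPoly α p, ?_⟩
    have : polyFun (p * X j) = fun x => x j * polyFun p x := by ext x; simp [mul_comm]
    ext x
    rw [this, diffQuot_coord_mul hα j (differentiableAt_polyFun p x), polyFun_add, polyFun_mul,
      polyFun_smul, polyFun_reflPoly, hp', polyFun_X]

lemma exists_polyFun_eq_dunklOp (P : Finset (EuclideanSpace ℝ (Fin d)))
    (κ : EuclideanSpace ℝ (Fin d) → ℝ) (ξ : EuclideanSpace ℝ (Fin d))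
    (p : MvPolynomial (Fin d) ℝ) : ∃ p', polyFun p' = dunklOp P κ ξ (polyFun p) := by
  choose q hq using fun α => exists_polyFun_eq_diffQuot α p
  refine ⟨∑ j, ξ j • pderiv j p + ∑ α ∈ P, (κ α * inner ℝ α ξ) • q α, ?_⟩
  ext x
  simp only [polyFun_add, dunklOp, fderiv_polyFun, polyFun_sum, polyFun_smul, hq]

end PolyFun

section DunklEnd

variable {d : ℕ} (P : Finset (EuclideanSpace ℝ (Fin d))) (κ : EuclideanSpace ℝ (Fin d) → ℝ)

/-- The Dunkl operator `𝒟_ξ` on polynomials. -/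
def dunklEnd (ξ : EuclideanSpace ℝ (Fin d)) :
    MvPolynomial (Fin d) ℝ →ₗ[ℝ] MvPolynomial (Fin d) ℝ where
  toFun p := (exists_polyFun_eq_dunklOp P κ ξ p).choose
  map_add' p q := polyFun_injective <| by
    ext x
    have : polyFun (p + q) = fun x => polyFun p x + polyFun q x := by ext x; simp
    rw [polyFun_add, (exists_polyFun_eq_dunklOp P κ ξ _).choose_spec,
      (exists_polyFun_eq_dunklOp P κ ξ _).choose_spec,
      (exists_polyFun_eq_dunklOp P κ ξ _).choose_spec, this,
      dunklOp_add_fun (differentiableAt_polyFun p x) (differentiableAt_polyFun q x)]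
  map_smul' c p := polyFun_injective <| by
    ext x
    have : polyFun (c • p) = fun x => c * polyFun p x := by ext x; simp
    rw [RingHom.id_apply, polyFun_smul, (exists_polyFun_eq_dunklOp P κ ξ _).choose_spec,
      (exists_polyFun_eq_dunklOp P κ ξ _).choose_spec, this,
      dunklOp_const_mul (differentiableAt_polyFun p x)]

lemma polyFun_dunklEnd (ξ : EuclideanSpace ℝ (Fin d)) (p : MvPolynomial (Fin d) ℝ) :
    polyFun (dunklEnd P κ ξ p) = dunklOp P κ ξ (polyFun p) :=
  (exists_polyFun_eq_dunklOp P κ ξ p).choose_spec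

lemma dunklEnd_C (ξ : EuclideanSpace ℝ (Fin d)) (c : ℝ) : dunklEnd P κ ξ (C c) = 0 := by
  apply polyFun_injective
  have : polyFun (C c) = fun _ : EuclideanSpace ℝ (Fin d) => c := by ext x; simp
  ext x
  rw [polyFun_dunklEnd, this, dunklOp_const, polyFun_zero]

lemma dunklEnd_add (ξ η : EuclideanSpace ℝ (Fin d)) (p : MvPolynomial (Fin d) ℝ) :
    dunklEnd P κ (ξ + η) p = dunklEnd P κ ξ p + dunklEnd P κ η p := by
  apply polyFun_injective
  ext x
  simp only [polyFun_dunklEnd, polyFun_add, dunklOp_add]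

lemma dunklEnd_smul (c : ℝ) (ξ : EuclideanSpace ℝ (Fin d)) (p : MvPolynomial (Fin d) ℝ) :
    dunklEnd P κ (c • ξ) p = c • dunklEnd P κ ξ p := by
  apply polyFun_injective
  ext x
  simp only [polyFun_dunklEnd, polyFun_smul, dunklOp_smul]

lemma dunklEnd_sum_single (ξ : EuclideanSpace ℝ (Fin d)) (p : MvPolynomial (Fin d) ℝ) :
    ∑ i, ξ i • dunklEnd P κ (EuclideanSpace.single i 1) p = dunklEnd P κ ξ p := by
  let L : EuclideanSpace ℝ (Fin d) →ₗ[ℝ] MvPolynomial (Fin d) ℝ :=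
    { toFun := fun ξ => dunklEnd P κ ξ p
      map_add' := fun ξ η => dunklEnd_add P κ ξ η p
      map_smul' := fun c ξ => dunklEnd_smul P κ c ξ p }
  have h : ξ = ∑ i, ξ i • EuclideanSpace.single i (1 : ℝ) := by
    ext k
    simp [Finset.sum_apply, Pi.single_apply]
  change ∑ i, ξ i • L (EuclideanSpace.single i 1) = L ξ
  conv_rhs => rw [h, map_sum]
  simp

variable {P κ}

lemma dunklEnd_X_mul (hP : ∀ α ∈ P, α ≠ 0) (ξ : EuclideanSpace ℝ (Fin d)) (j : Fin d)
    (p : MvPolynomial (Fin d) ℝ) :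
    dunklEnd P κ ξ (X j * p) = X j * dunklEnd P κ ξ p + ξ j • p
      + ∑ α ∈ P, (2 * κ α * inner ℝ α ξ / ‖α‖ ^ 2 * α j) • reflPoly α p := by
  apply polyFun_injective
  have : polyFun (X j * p) = fun x => x j * polyFun p x := by ext x; simp
  ext x
  rw [polyFun_dunklEnd, this, dunklOp_coord_mul hP j (differentiableAt_polyFun p x)]
  simp [polyFun_dunklEnd, polyFun_reflPoly]

variable {R : Finset (EuclideanSpace ℝ (Fin d))}

lemma IsPositiveSystem.subset (hP : IsPositiveSystem R P) : P ⊆ R := fun α hα => by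
  obtain ⟨b, -, hb⟩ := hP
  exact ((hb α).1 hα).1

lemma IsPositiveSystem.ne_zero (hR : IsReducedRootSystem R) (hP : IsPositiveSystem R P) :
    ∀ α ∈ P, α ≠ 0 := fun α hα => hR.ne_zero α (hP.subset hα)

lemma dunklEnd_reflPoly (hR : IsReducedRootSystem R) (hP : IsPositiveSystem R P)
    (hκ : IsMultiplicity R κ) {β : EuclideanSpace ℝ (Fin d)} (hβ : β ∈ P)
    (ξ : EuclideanSpace ℝ (Fin d)) (p : MvPolynomial (Fin d) ℝ) :
    dunklEnd P κ ξ (reflPoly β p) = reflPoly β (dunklEnd P κ ξ p)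
      - (2 * inner ℝ β ξ / ‖β‖ ^ 2) • reflPoly β (dunklEnd P κ β p) := by
  have h : dunklEnd P κ ξ (reflPoly β p) = reflPoly β (dunklEnd P κ (𝔯 β ξ) p) := by
    apply polyFun_injective
    have : polyFun (reflPoly β p) = fun x => polyFun p (𝔯 β x) := by
      ext x; rw [polyFun_reflPoly]
    ext x
    rw [polyFun_reflPoly, polyFun_dunklEnd, polyFun_dunklEnd, this,
      dunklOp_comp_reflection hR hP hκ hβ]
  rw [h, reflection_eq, sub_eq_add_neg, ← neg_smul, dunklEnd_add, dunklEnd_smul, map_add, map_smul,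
    neg_smul, ← sub_eq_add_neg]

lemma dunklEnd_comm (hR : IsReducedRootSystem R) (hP : IsPositiveSystem R P)
    (hκ : IsMultiplicity R κ) (ξ η : EuclideanSpace ℝ (Fin d)) (p : MvPolynomial (Fin d) ℝ) :
    dunklEnd P κ ξ (dunklEnd P κ η p) = dunklEnd P κ η (dunklEnd P κ ξ p) := by
  have h0 := hP.ne_zero hR
  induction p using MvPolynomial.induction_on with
  | C a => simp [dunklEnd_C]
  | add p q hp hq => simp [hp, hq]
  | mul_X p j hp =>
    rw [mul_comm, dunklEnd_X_mul h0, dunklEnd_X_mul h0]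
    simp only [map_add, map_sum, map_smul, dunklEnd_X_mul h0, hp]
    have key : ∑ α ∈ P, (2 * κ α * inner ℝ α ξ / ‖α‖ ^ 2 * α j) • reflPoly α (dunklEnd P κ η p)
        + ∑ α ∈ P, (2 * κ α * inner ℝ α η / ‖α‖ ^ 2 * α j) • dunklEnd P κ ξ (reflPoly α p)
        = ∑ α ∈ P, (2 * κ α * inner ℝ α η / ‖α‖ ^ 2 * α j) • reflPoly α (dunklEnd P κ ξ p)
        + ∑ α ∈ P, (2 * κ α * inner ℝ α ξ / ‖α‖ ^ 2 * α j) • dunklEnd P κ η (reflPoly α p) := by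
      rw [← Finset.sum_add_distrib, ← Finset.sum_add_distrib]
      refine Finset.sum_congr rfl fun α hα => ?_
      rw [dunklEnd_reflPoly hR hP hκ hα, dunklEnd_reflPoly hR hP hκ hα]
      module
    linear_combination (exp := 1) key

variable (P κ) in
/-- The Dunkl Laplacian on polynomials. -/
def lapEnd : MvPolynomial (Fin d) ℝ →ₗ[ℝ] MvPolynomial (Fin d) ℝ :=
  ∑ j, dunklEnd P κ (EuclideanSpace.single j 1) ∘ₗ dunklEnd P κ (EuclideanSpace.single j 1)

lemma lapEnd_apply (p : MvPolynomial (Fin d) ℝ) : lapEnd P κ p = ∑ j,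
    dunklEnd P κ (EuclideanSpace.single j 1) (dunklEnd P κ (EuclideanSpace.single j 1) p) := by
  simp [lapEnd]

lemma polyFun_lapEnd (p : MvPolynomial (Fin d) ℝ) :
    polyFun (lapEnd P κ p) = dunklLaplacian P κ (polyFun p) := by
  ext x
  simp only [lapEnd_apply, polyFun_sum, dunklLaplacian, dunklPartial, polyFun_dunklEnd]

lemma lapEnd_dunklEnd (hR : IsReducedRootSystem R) (hP : IsPositiveSystem R P)
    (hκ : IsMultiplicity R κ) (ξ : EuclideanSpace ℝ (Fin d)) (p : MvPolynomial (Fin d) ℝ) :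
    lapEnd P κ (dunklEnd P κ ξ p) = dunklEnd P κ ξ (lapEnd P κ p) := by
  rw [lapEnd_apply, lapEnd_apply, map_sum]
  refine Finset.sum_congr rfl fun j _ => ?_
  rw [dunklEnd_comm hR hP hκ _ ξ, dunklEnd_comm hR hP hκ _ ξ]

lemma lapEnd_X_mul (hR : IsReducedRootSystem R) (hP : IsPositiveSystem R P)
    (hκ : IsMultiplicity R κ) (j : Fin d) (p : MvPolynomial (Fin d) ℝ) :
    lapEnd P κ (X j * p) = X j * lapEnd P κ p
      + (2 : ℝ) • dunklEnd P κ (EuclideanSpace.single j 1) p := by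
  have h0 := hP.ne_zero hR
  have hD (i : Fin d) : dunklEnd P κ (EuclideanSpace.single i 1)
      (dunklEnd P κ (EuclideanSpace.single i 1) (X j * p))
      = X j * dunklEnd P κ (EuclideanSpace.single i 1) (dunklEnd P κ (EuclideanSpace.single i 1) p)
        + (2 * (if j = i then (1 : ℝ) else 0)) • dunklEnd P κ (EuclideanSpace.single i 1) p
        + ∑ α ∈ P, (2 * κ α * α j / ‖α‖ ^ 2) • (reflPoly α
            ((2 * α i) • dunklEnd P κ (EuclideanSpace.single i 1) p)
            - (2 * α i * α i / ‖α‖ ^ 2) • reflPoly α (dunklEnd P κ α p)) := by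
    rw [dunklEnd_X_mul h0, map_add, map_add, dunklEnd_X_mul h0, map_sum]
    have h1 : ∀ a b c e f g u v w : MvPolynomial (Fin d) ℝ, e = u + v → b + c = g → f = w →
        a + b + f + c + e = a + g + (w + u + v) := by
      rintro a b c e f g u v w rfl rfl rfl; abel
    rw [show ∑ α ∈ P, (2 * κ α * α j / ‖α‖ ^ 2) • (reflPoly α
            ((2 * α i) • dunklEnd P κ (EuclideanSpace.single i 1) p)
            - (2 * α i * α i / ‖α‖ ^ 2) • reflPoly α (dunklEnd P κ α p))
        = ∑ α ∈ P, (2 * κ α * inner ℝ α (EuclideanSpace.single i 1) / ‖α‖ ^ 2 * α j) •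
            reflPoly α (dunklEnd P κ (EuclideanSpace.single i 1) p)
          + ∑ α ∈ P, (2 * κ α * inner ℝ α (EuclideanSpace.single i 1) / ‖α‖ ^ 2 * α j) •
            dunklEnd P κ (EuclideanSpace.single i 1) (reflPoly α p) from ?_]
    · simp only [map_smul, PiLp.single_apply]
      module
    · rw [← Finset.sum_add_distrib]
      refine Finset.sum_congr rfl fun α hα => ?_
      rw [dunklEnd_reflPoly hR hP hκ hα]
      simp only [EuclideanSpace.inner_single_right, map_smul, one_mul, conj_trivial]
      module
  rw [lapEnd_apply, Finset.sum_congr rfl fun i _ => hD i, Finset.sum_add_distrib,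
    Finset.sum_add_distrib, Finset.sum_comm, ← Finset.mul_sum, ← lapEnd_apply]
  have h2 : ∑ α ∈ P, ∑ i, (2 * κ α * α j / ‖α‖ ^ 2) • (reflPoly α
      ((2 * α i) • dunklEnd P κ (EuclideanSpace.single i 1) p)
      - (2 * α i * α i / ‖α‖ ^ 2) • reflPoly α (dunklEnd P κ α p)) = 0 := by
    refine Finset.sum_eq_zero fun α hα => ?_
    have hn : ‖α‖ ≠ 0 := norm_ne_zero_iff.2 (h0 α hα)
    rw [← Finset.smul_sum, Finset.sum_sub_distrib, ← map_sum, ← Finset.sum_smul]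
    have h3 : ∑ i, (2 * α i) • dunklEnd P κ (EuclideanSpace.single i 1) p
        = (2 : ℝ) • dunklEnd P κ α p := by
      rw [← dunklEnd_sum_single P κ α p, Finset.smul_sum]
      simp only [smul_smul]
    have h4 : ∑ i, 2 * α i * α i / ‖α‖ ^ 2 = 2 := by
      rw [← Finset.sum_div]
      have : ∑ i, 2 * α i * α i = 2 * ‖α‖ ^ 2 := by
        rw [EuclideanSpace.real_norm_sq_eq, Finset.mul_sum]
        exact Finset.sum_congr rfl fun i _ => by ring
      rw [this]
      field_simp
    rw [h3, h4, map_smul, sub_self, smul_zero]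
  rw [h2, add_zero]
  congr 1
  rw [Finset.sum_eq_single j (fun b _ hb => by simp [Ne.symm hb]) (by simp)]
  simp

lemma lapEnd_iterate_X_mul (hR : IsReducedRootSystem R) (hP : IsPositiveSystem R P)
    (hκ : IsMultiplicity R κ) (j : Fin d) (p : MvPolynomial (Fin d) ℝ) (n : ℕ) :
    (lapEnd P κ)^[n + 1] (X j * p) = X j * (lapEnd P κ)^[n + 1] p
      + (2 * (n + 1 : ℝ)) • dunklEnd P κ (EuclideanSpace.single j 1) ((lapEnd P κ)^[n] p) := by
  induction n with
  | zero => simpa using lapEnd_X_mul hR hP hκ j p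
  | succ n ih =>
    rw [Function.iterate_succ_apply', ih, map_add, lapEnd_X_mul hR hP hκ, map_smul,
      lapEnd_dunklEnd hR hP hκ, ← Function.iterate_succ_apply' (lapEnd P κ),
      ← Function.iterate_succ_apply' (lapEnd P κ)]
    push_cast
    module

end DunklEnd

section Degree

variable {d : ℕ}

/-- A linear operator on polynomials that lowers the degree of homogeneous polynomials by `m`. -/
def LowersDegree (T : Module.End ℝ (MvPolynomial (Fin d) ℝ)) (m : ℕ) : Prop :=
  ∀ k p, p.IsHomogeneous k → (T p).IsHomogeneous (k - m) ∧ (k < m → T p = 0)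

lemma LowersDegree.one : LowersDegree (1 : Module.End ℝ (MvPolynomial (Fin d) ℝ)) 0 :=
  fun _ _ hp => ⟨hp, fun h => absurd h (Nat.not_lt_zero _)⟩

lemma LowersDegree.mul {S T : Module.End ℝ (MvPolynomial (Fin d) ℝ)} {m n : ℕ}
    (hS : LowersDegree S m) (hT : LowersDegree T n) : LowersDegree (S * T) (m + n) := by
  intro k p hp
  obtain ⟨h1, h2⟩ := hT k p hp
  obtain ⟨h3, h4⟩ := hS _ _ h1
  refine ⟨by rwa [Nat.sub_sub, add_comm n m] at h3, fun h => ?_⟩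
  rw [Module.End.mul_apply]
  by_cases hk : k < n
  · rw [h2 hk, map_zero]
  · exact h4 (by omega)

lemma LowersDegree.pow {S : Module.End ℝ (MvPolynomial (Fin d) ℝ)} {m : ℕ}
    (hS : LowersDegree S m) (n : ℕ) : LowersDegree (S ^ n) (n * m) := by
  induction n with
  | zero => simpa using LowersDegree.one
  | succ n ih =>
    rw [pow_succ, add_mul, one_mul]
    exact ih.mul hS

lemma LowersDegree.sum {ι : Type*} (s : Finset ι) {S : ι → Module.End ℝ (MvPolynomial (Fin d) ℝ)}
    {m : ℕ} (hS : ∀ i ∈ s, LowersDegree (S i) m) : LowersDegree (∑ i ∈ s, S i) m := by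
  intro k p hp
  rw [LinearMap.sum_apply]
  exact ⟨IsHomogeneous.sum _ _ _ fun i hi => (hS i hi k p hp).1,
    fun h => Finset.sum_eq_zero fun i hi => (hS i hi k p hp).2 h⟩

lemma LowersDegree.smul {S : Module.End ℝ (MvPolynomial (Fin d) ℝ)} {m : ℕ}
    (hS : LowersDegree S m) (c : ℝ) : LowersDegree (c • S) m := by
  intro k p hp
  obtain ⟨h1, h2⟩ := hS k p hp
  rw [LinearMap.smul_apply, smul_eq_C_mul]
  exact ⟨h1.C_mul c, fun h => by rw [h2 h, mul_zero]⟩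

lemma LowersDegree.list_prod {ι : Type*} (l : List ι)
    {S : ι → Module.End ℝ (MvPolynomial (Fin d) ℝ)} {m : ι → ℕ}
    (hS : ∀ i, LowersDegree (S i) (m i)) : LowersDegree (l.map S).prod (l.map m).sum := by
  induction l with
  | nil => simpa using LowersDegree.one
  | cons i l ih => simpa using (hS i).mul ih

variable {P : Finset (EuclideanSpace ℝ (Fin d))} {κ : EuclideanSpace ℝ (Fin d) → ℝ}

lemma lowersDegree_dunklEnd (hP : ∀ α ∈ P, α ≠ 0) (ξ : EuclideanSpace ℝ (Fin d)) :
    LowersDegree (dunklEnd P κ ξ) 1 := by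
  have key : ∀ k, ∀ s : Fin d →₀ ℕ, s.degree = k → ∀ c : ℝ,
      (dunklEnd P κ ξ (monomial s c)).IsHomogeneous (k - 1) ∧
        (k < 1 → dunklEnd P κ ξ (monomial s c) = 0) := by
    intro k
    induction k with
    | zero =>
      intro s hs c
      rw [Finsupp.degree_eq_zero_iff] at hs
      subst hs
      have : dunklEnd P κ ξ (monomial 0 c) = 0 := dunklEnd_C P κ ξ c
      rw [this]
      exact ⟨isHomogeneous_zero _ _ _, fun _ => rfl⟩
    | succ k ih =>
      intro s hs c
      refine ⟨?_, fun h => absurd h (by omega)⟩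
      have hs0 : s ≠ 0 := by rintro rfl; simp at hs
      obtain ⟨j, hj⟩ := Finsupp.support_nonempty_iff.2 hs0
      have hle : Finsupp.single j 1 ≤ s := by
        rw [Finsupp.single_le_iff]
        exact Nat.one_le_iff_ne_zero.2 (Finsupp.mem_support_iff.1 hj)
      obtain ⟨t, rfl⟩ := exists_add_of_le hle
      have ht : t.degree = k := by
        rw [map_add, Finsupp.degree_single] at hs
        omega
      have hm : monomial (Finsupp.single j 1 + t) c = X j * monomial t c := by
        rw [X, monomial_mul, one_mul]
      have hth : (monomial t c).IsHomogeneous k := isHomogeneous_monomial c ht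
      obtain ⟨h1, h2⟩ := ih t ht c
      rw [hm, dunklEnd_X_mul hP, Nat.add_sub_cancel]
      refine (IsHomogeneous.add ?_ ?_).add (IsHomogeneous.sum _ _ _ fun α _ => ?_)
      · by_cases hk : k < 1
        · rw [h2 hk, mul_zero]
          exact isHomogeneous_zero _ _ _
        · have := (isHomogeneous_X ℝ j).mul h1
          rwa [show 1 + (k - 1) = k by omega] at this
      · rw [smul_eq_C_mul]
        exact hth.C_mul _
      · rw [smul_eq_C_mul]
        exact (isHomogeneous_reflPoly α hth).C_mul _
  intro k p hp
  have hs : ∀ s ∈ p.support, s.degree = k := fun s hs => by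
    rw [Finsupp.degree_eq_weight_one]
    exact hp (mem_support_iff.1 hs)
  rw [p.as_sum, map_sum]
  exact ⟨IsHomogeneous.sum _ _ _ fun s h => (key k s (hs s h) _).1,
    fun h => Finset.sum_eq_zero fun s h' => (key k s (hs s h') _).2 h⟩

lemma lowersDegree_lapEnd (hP : ∀ α ∈ P, α ≠ 0) : LowersDegree (lapEnd P κ) 2 :=
  LowersDegree.sum _ fun _ _ => (lowersDegree_dunklEnd hP _).mul (lowersDegree_dunklEnd hP _)

variable (P κ) in
/-- `𝒟^s` on polynomials. -/
def dunklMonomialEnd (s : Fin d →₀ ℕ) : Module.End ℝ (MvPolynomial (Fin d) ℝ) :=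
  ((List.finRange d).map fun j => dunklEnd P κ (EuclideanSpace.single j 1) ^ s j).prod

lemma polyFun_dunklMonomialEnd (s : Fin d →₀ ℕ) (p : MvPolynomial (Fin d) ℝ) :
    polyFun (dunklMonomialEnd P κ s p) = dunklMonomial P κ s (polyFun p) := by
  rw [dunklMonomialEnd, dunklMonomial]
  induction List.finRange d with
  | nil => simp
  | cons j l ih =>
    have h (n : ℕ) (p : MvPolynomial (Fin d) ℝ) :
        polyFun ((dunklEnd P κ (EuclideanSpace.single j 1) ^ n) p)
          = (dunklPartial P κ j)^[n] (polyFun p) := by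
      induction n with
      | zero => simp
      | succ n ih =>
        rw [pow_succ', Module.End.mul_apply, polyFun_dunklEnd, ih, Function.iterate_succ_apply']
        rfl
    rw [List.map_cons, List.prod_cons, Module.End.mul_apply, List.foldr_cons, h, ih]

lemma lowersDegree_dunklMonomialEnd (hP : ∀ α ∈ P, α ≠ 0) (s : Fin d →₀ ℕ) :
    LowersDegree (dunklMonomialEnd P κ s) s.degree := by
  have := LowersDegree.list_prod (List.finRange d)
    fun j => (lowersDegree_dunklEnd (κ := κ) hP (EuclideanSpace.single j 1)).pow (s j)
  simp only [mul_one] at this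
  rwa [show ((List.finRange d).map fun j => s j).sum = s.degree from ?_] at this
  rw [Finsupp.degree_eq_sum, ← List.ofFn_eq_map, List.sum_ofFn]

variable (P κ) in
/-- `q(𝒟)` on polynomials. -/
def dunklPolyEnd (q : MvPolynomial (Fin d) ℝ) : Module.End ℝ (MvPolynomial (Fin d) ℝ) :=
  ∑ s ∈ q.support, q.coeff s • dunklMonomialEnd P κ s

lemma polyFun_dunklPolyEnd (q p : MvPolynomial (Fin d) ℝ) :
    polyFun (dunklPolyEnd P κ q p) = dunklPoly P κ q (polyFun p) := by
  ext x
  simp [dunklPolyEnd, dunklPoly, LinearMap.sum_apply, polyFun_dunklMonomialEnd]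

lemma lowersDegree_dunklPolyEnd (hP : ∀ α ∈ P, α ≠ 0) {q : MvPolynomial (Fin d) ℝ} {m : ℕ}
    (hq : q.IsHomogeneous m) : LowersDegree (dunklPolyEnd P κ q) m := by
  refine LowersDegree.sum _ fun s hs => ?_
  have : s.degree = m := by
    rw [Finsupp.degree_eq_weight_one]
    exact hq (mem_support_iff.1 hs)
  exact this ▸ (lowersDegree_dunklMonomialEnd hP s).smul _

lemma commute_lapEnd_dunklPolyEnd {R : Finset (EuclideanSpace ℝ (Fin d))}
    (hR : IsReducedRootSystem R) (hP : IsPositiveSystem R P)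
    (hκ : IsMultiplicity R κ) (q : MvPolynomial (Fin d) ℝ) :
    Commute (lapEnd P κ) (dunklPolyEnd P κ q) := by
  refine Commute.sum_right _ _ _ fun s _ => Commute.smul_right ?_ _
  refine Commute.list_prod_right _ _ fun T hT => ?_
  obtain ⟨j, -, rfl⟩ := List.mem_map.1 hT
  refine Commute.pow_right ?_ _
  exact LinearMap.ext fun p => lapEnd_dunklEnd hR hP hκ _ p

/-- The Dunkl form of Euler's identity. -/
lemma sum_X_mul_dunklEnd {k : ℕ} {p : MvPolynomial (Fin d) ℝ} (hp : p.IsHomogeneous k) :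
    ∑ j, X j * dunklEnd P κ (EuclideanSpace.single j 1) p
      = (k : ℝ) • p + ∑ α ∈ P, κ α • (p - reflPoly α p) := by
  apply polyFun_injective
  ext x
  have h1 : polyFun (∑ j, X j * dunklEnd P κ (EuclideanSpace.single j 1) p) x
      = dunklOp P κ x (polyFun p) x := by
    rw [← polyFun_dunklEnd, ← dunklEnd_sum_single P κ x p]
    simp
  have h2 : polyFun (∑ j, x j • pderiv j p) x = k * polyFun p x := by
    have := congrArg (polyFun · x) hp.sum_X_mul_pderiv
    simp only [← Nat.cast_smul_eq_nsmul ℝ, polyFun_sum, polyFun_smul, polyFun_mul, polyFun_X]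
      at this ⊢
    exact this
  rw [h1, dunklOp, fderiv_polyFun, h2, polyFun_add, polyFun_smul, polyFun_sum]
  congr 1
  refine Finset.sum_congr rfl fun α _ => ?_
  rw [mul_assoc, inner_mul_diffQuot, polyFun_smul, polyFun_sub, polyFun_reflPoly]

end Degree

section HeatOperator

variable {d : ℕ} {R P : Finset (EuclideanSpace ℝ (Fin d))} {κ : EuclideanSpace ℝ (Fin d) → ℝ}

lemma lapEnd_pow_eq_zero (hP : ∀ α ∈ P, α ≠ 0) {p : MvPolynomial (Fin d) ℝ} {n : ℕ}
    (hn : p.totalDegree < n) : (lapEnd P κ ^ n) p = 0 := by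
  rw [← sum_homogeneousComponent p, map_sum]
  refine Finset.sum_eq_zero fun i hi => ?_
  refine ((lowersDegree_lapEnd hP).pow n i _ (homogeneousComponent_isHomogeneous i p)).2 ?_
  have := Finset.mem_range.1 hi
  omega

variable (P κ) in
/-- The first `N` terms of the exponential series of `-Δ / 2`. -/
def heatTrunc (N : ℕ) : Module.End ℝ (MvPolynomial (Fin d) ℝ) :=
  ∑ n ∈ Finset.range N, ((-1 / 2 : ℝ) ^ n / n.factorial) • lapEnd P κ ^ n

lemma heatTrunc_eq (hP : ∀ α ∈ P, α ≠ 0) {p : MvPolynomial (Fin d) ℝ} {M N : ℕ}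
    (hM : p.totalDegree < M) (hMN : M ≤ N) : heatTrunc P κ N p = heatTrunc P κ M p := by
  simp only [heatTrunc, LinearMap.sum_apply, LinearMap.smul_apply]
  refine (Finset.sum_subset (Finset.range_mono hMN) fun n _ hn => ?_).symm
  rw [lapEnd_pow_eq_zero hP, smul_zero]
  have := Finset.mem_range.not.1 hn
  omega

variable (P κ) in
/-- The operator `exp (-Δ / 2)` on polynomials. -/
def heat (p : MvPolynomial (Fin d) ℝ) : MvPolynomial (Fin d) ℝ :=
  heatTrunc P κ (p.totalDegree + 1) p

lemma heat_eq (hP : ∀ α ∈ P, α ≠ 0) {p : MvPolynomial (Fin d) ℝ} {N : ℕ}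
    (hN : p.totalDegree < N) : heat P κ p = heatTrunc P κ N p :=
  (heatTrunc_eq hP (Nat.lt_succ_self _) hN).symm

lemma heat_add (hP : ∀ α ∈ P, α ≠ 0) (p q : MvPolynomial (Fin d) ℝ) :
    heat P κ (p + q) = heat P κ p + heat P κ q := by
  have h := totalDegree_add p q
  have h1 : p.totalDegree < max p.totalDegree q.totalDegree + 1 := by omega
  have h2 : q.totalDegree < max p.totalDegree q.totalDegree + 1 := by omega
  rw [heat_eq hP (Nat.lt_succ_of_le h), heat_eq hP h1, heat_eq hP h2, map_add]

lemma heat_smul (hP : ∀ α ∈ P, α ≠ 0) (c : ℝ) (p : MvPolynomial (Fin d) ℝ) :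
    heat P κ (c • p) = c • heat P κ p := by
  rw [heat_eq hP (Nat.lt_succ_of_le (totalDegree_smul_le c p)), map_smul, heat]

lemma heat_sum (hP : ∀ α ∈ P, α ≠ 0) {ι : Type*} (s : Finset ι)
    (p : ι → MvPolynomial (Fin d) ℝ) : heat P κ (∑ i ∈ s, p i) = ∑ i ∈ s, heat P κ (p i) := by
  classical
  induction s using Finset.induction_on with
  | empty => simp [heat]
  | insert i s hi ih => rw [Finset.sum_insert hi, Finset.sum_insert hi, heat_add hP, ih]

lemma heat_of_lapEnd_eq_zero {p : MvPolynomial (Fin d) ℝ} (hp : lapEnd P κ p = 0) :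
    heat P κ p = p := by
  rw [heat, heatTrunc, Finset.sum_range_succ', LinearMap.add_apply, LinearMap.sum_apply]
  rw [Finset.sum_eq_zero fun n _ => by
    rw [LinearMap.smul_apply, pow_succ (lapEnd P κ), Module.End.mul_apply, hp, map_zero, smul_zero]]
  simp

lemma heat_one : heat P κ 1 = 1 :=
  heat_of_lapEnd_eq_zero <| by
    rw [lapEnd_apply]
    refine Finset.sum_eq_zero fun j _ => ?_
    rw [← C_1, dunklEnd_C, map_zero]

lemma heat_X_mul (hR : IsReducedRootSystem R) (hP : IsPositiveSystem R P)
    (hκ : IsMultiplicity R κ) (j : Fin d) (p : MvPolynomial (Fin d) ℝ) :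
    heat P κ (X j * p) = X j * heat P κ p
      - dunklEnd P κ (EuclideanSpace.single j 1) (heat P κ p) := by
  have h0 := hP.ne_zero hR
  have h1 : (X j * p).totalDegree < p.totalDegree + 1 + 1 := by
    have := totalDegree_mul (X j) p
    rw [totalDegree_X] at this
    omega
  rw [heat_eq h0 h1]
  conv_rhs => rw [heat_eq h0 (show p.totalDegree < p.totalDegree + 1 + 1 by omega)]
  conv_rhs => enter [2]; rw [heatTrunc_eq h0 (Nat.lt_succ_self _) (Nat.le_succ _)]
  simp only [heatTrunc, LinearMap.sum_apply, LinearMap.smul_apply, map_sum, map_smul,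
    Module.End.pow_apply]
  rw [Finset.sum_range_succ', Finset.sum_range_succ' _ (p.totalDegree + 1), mul_add,
    Finset.mul_sum, add_sub_right_comm, ← Finset.sum_sub_distrib]
  congr 1
  · refine Finset.sum_congr rfl fun n _ => ?_
    have hc : (-1 / 2 : ℝ) ^ (n + 1) / (n + 1).factorial * (2 * (n + 1))
        = - ((-1 / 2 : ℝ) ^ n / n.factorial) := by
      rw [Nat.factorial_succ]
      push_cast
      have : (n : ℝ) + 1 ≠ 0 := by positivity
      field_simp
      ring
    rw [lapEnd_iterate_X_mul hR hP hκ, smul_add, smul_smul, hc, neg_smul, mul_smul_comm,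
      sub_eq_add_neg]
  · simp

end HeatOperator

open MeasureTheory Filter

section PolyBounded

variable {d : ℕ}

/-- Functions of at most polynomial growth. -/
def PolyBounded (f : EuclideanSpace ℝ (Fin d) → ℝ) : Prop :=
  ∃ (C : ℝ) (K : ℕ), 0 ≤ C ∧ ∀ x, |f x| ≤ C * (1 + ‖x‖) ^ K

lemma PolyBounded.const (c : ℝ) : PolyBounded fun _ : EuclideanSpace ℝ (Fin d) => c :=
  ⟨|c|, 0, abs_nonneg c, fun x => by simp⟩

lemma PolyBounded.mul {f g : EuclideanSpace ℝ (Fin d) → ℝ} (hf : PolyBounded f)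
    (hg : PolyBounded g) : PolyBounded fun x => f x * g x := by
  obtain ⟨C, K, hC, h⟩ := hf
  obtain ⟨C', K', hC', h'⟩ := hg
  refine ⟨C * C', K + K', mul_nonneg hC hC', fun x => ?_⟩
  rw [abs_mul, pow_add, mul_mul_mul_comm]
  exact mul_le_mul (h x) (h' x) (abs_nonneg _) (by positivity)

lemma PolyBounded.add {f g : EuclideanSpace ℝ (Fin d) → ℝ} (hf : PolyBounded f)
    (hg : PolyBounded g) : PolyBounded fun x => f x + g x := by
  obtain ⟨C, K, hC, h⟩ := hf
  obtain ⟨C', K', hC', h'⟩ := hg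
  refine ⟨C + C', max K K', add_nonneg hC hC', fun x => (abs_add_le _ _).trans ?_⟩
  have h1 : (1 : ℝ) ≤ 1 + ‖x‖ := by linarith [norm_nonneg x]
  rw [add_mul]
  exact add_le_add
    ((h x).trans (mul_le_mul_of_nonneg_left (pow_le_pow_right₀ h1 (le_max_left _ _)) hC))
    ((h' x).trans (mul_le_mul_of_nonneg_left (pow_le_pow_right₀ h1 (le_max_right _ _)) hC'))

lemma PolyBounded.mono {f g : EuclideanSpace ℝ (Fin d) → ℝ} (hg : PolyBounded g)
    (h : ∀ x, |f x| ≤ |g x|) : PolyBounded f := by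
  obtain ⟨C, K, hC, h'⟩ := hg
  exact ⟨C, K, hC, fun x => (h x).trans (h' x)⟩

lemma PolyBounded.prod {ι : Type*} (s : Finset ι) {f : ι → EuclideanSpace ℝ (Fin d) → ℝ}
    (hf : ∀ i ∈ s, PolyBounded (f i)) : PolyBounded fun x => ∏ i ∈ s, f i x := by
  classical
  induction s using Finset.induction_on with
  | empty => simpa using PolyBounded.const 1
  | insert i s hi ih =>
    simp only [Finset.prod_insert hi]
    exact (hf i (Finset.mem_insert_self i s)).mul
      (ih fun j hj => hf j (Finset.mem_insert_of_mem hj))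

lemma PolyBounded.pow {f : EuclideanSpace ℝ (Fin d) → ℝ} (hf : PolyBounded f) (n : ℕ) :
    PolyBounded fun x => f x ^ n := by
  induction n with
  | zero => simpa using PolyBounded.const 1
  | succ n ih =>
    simp only [pow_succ]
    exact ih.mul hf

lemma polyBounded_inner (α : EuclideanSpace ℝ (Fin d)) : PolyBounded fun x => inner ℝ α x :=
  ⟨‖α‖, 1, norm_nonneg _, fun x => (abs_real_inner_le_norm α x).trans (by
    rw [pow_one]
    exact mul_le_mul_of_nonneg_left (by linarith) (norm_nonneg _))⟩

lemma polyBounded_polyFun (p : MvPolynomial (Fin d) ℝ) : PolyBounded (polyFun p) := by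
  induction p using MvPolynomial.induction_on with
  | C a => exact (PolyBounded.const a).mono fun x => by simp
  | add p q hp hq => exact (hp.add hq).mono fun x => by simp
  | mul_X p j hp =>
    refine (hp.mul (polyBounded_inner (EuclideanSpace.single j 1))).mono fun x => ?_
    simp [EuclideanSpace.inner_single_left]

/-- The Gaussian. -/
def gauss (x : EuclideanSpace ℝ (Fin d)) : ℝ := Real.exp (-‖x‖ ^ 2 / 2)

lemma gauss_pos (x : EuclideanSpace ℝ (Fin d)) : 0 < gauss x := Real.exp_pos _

lemma contDiff_gauss : ContDiff ℝ ∞ (gauss : EuclideanSpace ℝ (Fin d) → ℝ) :=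
  ((contDiff_norm_sq ℝ).neg.div_const 2).exp

lemma fderiv_gauss (x ξ : EuclideanSpace ℝ (Fin d)) :
    fderiv ℝ gauss x ξ = - inner ℝ x ξ * gauss x := by
  have h1 : HasFDerivAt (fun y : EuclideanSpace ℝ (Fin d) => -‖y‖ ^ 2 / 2)
      (-innerSL ℝ x) x := by
    have := ((hasStrictFDerivAt_norm_sq x).hasFDerivAt).const_mul (-1 / 2 : ℝ)
    have he : (fun y : EuclideanSpace ℝ (Fin d) => -‖y‖ ^ 2 / 2) = fun y => -1 / 2 * ‖y‖ ^ 2 := by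
      ext y; ring
    rw [he]
    refine this.congr_fderiv ?_
    ext y
    simp
    ring
  have h2 : HasFDerivAt gauss (gauss x • (-innerSL ℝ x)) x := h1.exp
  rw [h2.fderiv]
  simp [mul_comm]

lemma exists_pow_mul_exp_le (n : ℕ) :
    ∃ C : ℝ, 0 ≤ C ∧ ∀ t : ℝ, 0 ≤ t → (1 + t) ^ n * Real.exp (-t ^ 2 / 2) ≤ C := by
  refine ⟨n.factorial * Real.exp (3 / 2), by positivity, fun t ht => ?_⟩
  have h1 : (1 + t) ^ n ≤ n.factorial * Real.exp (1 + t) := by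
    have := Real.pow_div_factorial_le_exp (1 + t) (by linarith) n
    rwa [div_le_iff₀ (by positivity), mul_comm] at this
  calc (1 + t) ^ n * Real.exp (-t ^ 2 / 2)
      ≤ n.factorial * Real.exp (1 + t) * Real.exp (-t ^ 2 / 2) :=
        mul_le_mul_of_nonneg_right h1 (Real.exp_pos _).le
    _ = n.factorial * Real.exp (1 + t + -t ^ 2 / 2) := by rw [mul_assoc, ← Real.exp_add]
    _ ≤ n.factorial * Real.exp (3 / 2) := by
        gcongr
        nlinarith [sq_nonneg (t - 1)]

lemma PolyBounded.integrable {f : EuclideanSpace ℝ (Fin d) → ℝ} (hf : PolyBounded f)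
    (hm : AEStronglyMeasurable f volume) : Integrable fun x => f x * gauss x := by
  obtain ⟨C, K, hC, h⟩ := hf
  obtain ⟨C', hC', h'⟩ := exists_pow_mul_exp_le (K + (d + 1))
  have hI : Integrable (fun x : EuclideanSpace ℝ (Fin d) =>
      C * C' * (1 + ‖x‖) ^ (-((d : ℝ) + 1))) :=
    (integrable_one_add_norm (by simp)).const_mul _
  refine hI.mono' (hm.mul contDiff_gauss.continuous.aestronglyMeasurable)
    (Eventually.of_forall fun x => ?_)
  have h1 : 0 < 1 + ‖x‖ := by positivity
  rw [Real.norm_eq_abs, abs_mul, abs_of_pos (gauss_pos x), Real.rpow_neg h1.le,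
    ← div_eq_mul_inv, le_div_iff₀ (by positivity)]
  have h2 : (1 + ‖x‖) ^ ((d : ℝ) + 1) = (1 + ‖x‖) ^ (d + 1) := by
    rw [← Real.rpow_natCast]; push_cast; rfl
  rw [h2]
  calc |f x| * gauss x * (1 + ‖x‖) ^ (d + 1)
      ≤ C * (1 + ‖x‖) ^ K * gauss x * (1 + ‖x‖) ^ (d + 1) := by
        have := h x
        have := gauss_pos x
        gcongr
    _ = C * ((1 + ‖x‖) ^ (K + (d + 1)) * gauss x) := by ring
    _ ≤ C * C' := mul_le_mul_of_nonneg_left (h' _ (norm_nonneg x)) hC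

end PolyBounded

section Weight

variable {d : ℕ} {R P : Finset (EuclideanSpace ℝ (Fin d))} {κ : EuclideanSpace ℝ (Fin d) → ℝ}

variable (P κ) in
/-- The regularized squared weight `∏ (⟨α, x⟩² + ε) ^ κ_α`. -/
def regWeight (ε : ℝ) (x : EuclideanSpace ℝ (Fin d)) : ℝ :=
  ∏ α ∈ P, (inner ℝ α x ^ 2 + ε) ^ κ α

lemma weight_sq (x : EuclideanSpace ℝ (Fin d)) : weight P κ x ^ 2 = regWeight P κ 0 x := by
  rw [weight, regWeight, ← Finset.prod_pow]
  refine Finset.prod_congr rfl fun α _ => ?_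
  rw [add_zero, Real.rpow_pow_comm (abs_nonneg _), sq_abs]

lemma regWeight_reflection (hR : IsReducedRootSystem R) (hP : IsPositiveSystem R P)
    (hκ : IsMultiplicity R κ) {β : EuclideanSpace ℝ (Fin d)} (hβ : β ∈ P) (ε : ℝ)
    (x : EuclideanSpace ℝ (Fin d)) : regWeight P κ ε (𝔯 β x) = regWeight P κ ε x := by
  rw [regWeight, ← prod_positive_reflection hR hP hβ
    fun α => (inner ℝ α (𝔯 β x) ^ 2 + ε) ^ κ α]
  · refine Finset.prod_congr rfl fun α hα => ?_
    rw [LinearIsometryEquiv.inner_map_map, hκ.reflection (hP.subset hβ) (hP.subset hα)]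
  · intro α hα
    rw [hκ.neg hα, inner_neg_left, neg_sq]

lemma regWeight_nonneg {ε : ℝ} (hε : 0 ≤ ε) (x : EuclideanSpace ℝ (Fin d)) :
    0 ≤ regWeight P κ ε x :=
  Finset.prod_nonneg fun _ _ => Real.rpow_nonneg (by positivity) _

lemma regWeight_le (hκ : ∀ α ∈ P, 0 ≤ κ α) {ε : ℝ} (hε : 0 ≤ ε) (hε1 : ε ≤ 1)
    (x : EuclideanSpace ℝ (Fin d)) : regWeight P κ ε x ≤ regWeight P κ 1 x :=
  Finset.prod_le_prod (fun _ _ => Real.rpow_nonneg (by positivity) _) fun α hα =>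
    Real.rpow_le_rpow (by positivity) (by linarith) (hκ α hα)

lemma continuous_regWeight (hκ : ∀ α ∈ P, 0 ≤ κ α) :
    Continuous fun y : ℝ × EuclideanSpace ℝ (Fin d) => regWeight P κ y.1 y.2 :=
  continuous_finsetProd _ fun α hα => Continuous.rpow_const (by fun_prop)
    fun _ => Or.inr (hκ α hα)

lemma polyBounded_regWeight_one (κ : EuclideanSpace ℝ (Fin d) → ℝ) :
    PolyBounded (regWeight P κ 1) := by
  refine PolyBounded.prod P fun α _ => ?_
  have h1 : PolyBounded fun x => inner ℝ α x ^ 2 + 1 :=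
    ((polyBounded_inner α).pow 2).add (PolyBounded.const 1)
  refine (h1.pow ⌈κ α⌉₊).mono fun x => ?_
  have h2 : 1 ≤ inner ℝ α x ^ 2 + 1 := by nlinarith [sq_nonneg (inner ℝ α x)]
  rw [abs_of_nonneg (Real.rpow_nonneg (by linarith) _), abs_of_nonneg (by positivity),
    ← Real.rpow_natCast _ ⌈κ α⌉₊]
  exact Real.rpow_le_rpow_of_exponent_le h2 (Nat.le_ceil _)

lemma polyBounded_regWeight (hκ : ∀ α ∈ P, 0 ≤ κ α) {ε : ℝ} (hε : 0 ≤ ε) (hε1 : ε ≤ 1) :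
    PolyBounded (regWeight P κ ε) :=
  (polyBounded_regWeight_one κ).mono fun x => by
    rw [abs_of_nonneg (regWeight_nonneg hε x), abs_of_nonneg (regWeight_nonneg zero_le_one x)]
    exact regWeight_le hκ hε hε1 x

lemma hasFDerivAt_regWeight {ε : ℝ} (hε : 0 < ε) (x : EuclideanSpace ℝ (Fin d)) :
    ∃ L : EuclideanSpace ℝ (Fin d) →L[ℝ] ℝ, HasFDerivAt (regWeight P κ ε) L x ∧
      ∀ ξ, L ξ = regWeight P κ ε x *
        ∑ α ∈ P, κ α * inner ℝ α ξ * (2 * inner ℝ α x / (inner ℝ α x ^ 2 + ε)) := by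
  have hpos : ∀ α (y : EuclideanSpace ℝ (Fin d)), 0 < inner ℝ α y ^ 2 + ε := fun α y => by
    positivity
  have hexp : regWeight P κ ε = fun y => Real.exp (∑ α ∈ P,
      Real.log (inner ℝ α y ^ 2 + ε) * κ α) := by
    ext y
    rw [Real.exp_sum]
    exact Finset.prod_congr rfl fun α _ => Real.rpow_def_of_pos (hpos α y) _
  have h1 (α : EuclideanSpace ℝ (Fin d)) : HasFDerivAt (fun y => Real.log (inner ℝ α y ^ 2 + ε) * κ α)
      (κ α • (inner ℝ α x ^ 2 + ε)⁻¹ • ((2 : ℕ) • inner ℝ α x ^ 1) • innerSL ℝ α) x :=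
    (((((innerSL ℝ α).hasFDerivAt (x := x)).pow 2).add_const ε).log (hpos α x).ne').mul_const (κ α)
  have h2 := (HasFDerivAt.fun_sum fun α (_ : α ∈ P) => h1 α).exp
  rw [← hexp] at h2
  refine ⟨_, h2, fun ξ => ?_⟩
  rw [smul_apply, smul_eq_mul, ← congrFun hexp x, sum_apply]
  congr 1
  refine Finset.sum_congr rfl fun α _ => ?_
  simp
  ring

end Weight

section GaussInt

variable {d : ℕ} {R P : Finset (EuclideanSpace ℝ (Fin d))} {κ : EuclideanSpace ℝ (Fin d) → ℝ}

/-- The limit of regularized weighted Gaussian integrals. -/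
lemma tendsto_integral_regWeight (hκ : ∀ α ∈ P, 0 ≤ κ α) {u : EuclideanSpace ℝ (Fin d) → ℝ}
    (hu : PolyBounded u) (huc : Continuous u) {k : ℝ → EuclideanSpace ℝ (Fin d) → ℝ}
    (hk : ∀ ε, 0 < ε → Continuous (k ε)) (hk1 : ∀ ε, 0 < ε → ∀ x, |k ε x| ≤ 1)
    (hlim : ∀ᵐ x, Tendsto (fun ε => k ε x) (𝓝[>] 0) (𝓝 1)) :
    Tendsto (fun ε => ∫ x, u x * k ε x * regWeight P κ ε x * gauss x) (𝓝[>] 0)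
      (𝓝 (∫ x, u x * regWeight P κ 0 x * gauss x)) := by
  have hev : ∀ᶠ ε in 𝓝[>] (0 : ℝ), 0 < ε ∧ ε ≤ 1 := by
    filter_upwards [Ioc_mem_nhdsGT (zero_lt_one' ℝ)] with ε hε using hε
  have hbound : Integrable fun x => ‖u x * regWeight P κ 1 x * gauss x‖ := by
    refine Integrable.norm ((hu.mul (polyBounded_regWeight_one κ)).integrable ?_)
    exact (huc.mul ((continuous_regWeight hκ).comp
      (Continuous.prodMk_right 1))).aestronglyMeasurable
  refine tendsto_integral_filter_of_dominated_convergence _ ?_ ?_ hbound ?_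
  · filter_upwards [hev] with ε hε
    exact (((huc.mul (hk ε hε.1)).mul ((continuous_regWeight hκ).comp
      (Continuous.prodMk_right ε))).mul contDiff_gauss.continuous).aestronglyMeasurable
  · filter_upwards [hev] with ε hε
    refine Eventually.of_forall fun x => ?_
    rw [norm_mul, norm_mul, norm_mul, norm_mul, norm_mul]
    refine mul_le_mul_of_nonneg_right ?_ (norm_nonneg _)
    refine mul_le_mul ?_ ?_ (norm_nonneg _) (norm_nonneg _)
    · exact mul_le_of_le_one_right (norm_nonneg _) (hk1 ε hε.1 x)
    · rw [Real.norm_of_nonneg (regWeight_nonneg hε.1.le x),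
        Real.norm_of_nonneg (regWeight_nonneg zero_le_one x)]
      exact regWeight_le hκ hε.1.le hε.2 x
  · filter_upwards [hlim] with x hx
    have h1 : Tendsto (fun ε => regWeight P κ ε x) (𝓝[>] 0) (𝓝 (regWeight P κ 0 x)) :=
      (((continuous_regWeight hκ).comp (Continuous.prodMk_left x)).tendsto 0).mono_left
        nhdsWithin_le_nhds
    simpa using ((hx.const_mul (u x)).mul h1).mul_const (gauss x)

lemma ae_inner_ne_zero {α : EuclideanSpace ℝ (Fin d)} (hα : α ≠ 0) :
    ∀ᵐ x : EuclideanSpace ℝ (Fin d), inner ℝ α x ≠ 0 := by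
  have h1 : (ℝ ∙ α)ᗮ ≠ ⊤ := by
    intro h
    have h2 : α ∈ (ℝ ∙ α)ᗮ := h ▸ Submodule.mem_top
    rw [Submodule.mem_orthogonal_singleton_iff_inner_right] at h2
    exact hα (inner_self_eq_zero.1 h2)
  have h2 := Measure.addHaar_submodule (volume : Measure (EuclideanSpace ℝ (Fin d))) _ h1
  rw [ae_iff]
  convert h2 using 2
  ext x
  simp [Submodule.mem_orthogonal_singleton_iff_inner_right]

lemma integral_comp_reflection (β : EuclideanSpace ℝ (Fin d)) (F : EuclideanSpace ℝ (Fin d) → ℝ) :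
    ∫ x, F (𝔯 β x) = ∫ x, F x :=
  (LinearIsometryEquiv.measurePreserving (𝔯 β)).integral_comp
    (𝔯 β).toHomeomorph.measurableEmbedding F

lemma gauss_reflection (β x : EuclideanSpace ℝ (Fin d)) : gauss (𝔯 β x) = gauss x := by
  simp [gauss]

lemma continuous_regWeight_right (hκ : ∀ α ∈ P, 0 ≤ κ α) (ε : ℝ) :
    Continuous (regWeight P κ ε) :=
  continuous_finsetProd _ fun α hα => Continuous.rpow_const (by fun_prop)
    fun _ => Or.inr (hκ α hα)

lemma integrable_regWeight (hκ : ∀ α ∈ P, 0 ≤ κ α) {ε : ℝ} (hε : 0 ≤ ε) (hε1 : ε ≤ 1)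
    {u : EuclideanSpace ℝ (Fin d) → ℝ} (hu : PolyBounded u) (huc : Continuous u) :
    Integrable fun x => u x * regWeight P κ ε x * gauss x :=
  (hu.mul (polyBounded_regWeight hκ hε hε1)).integrable
    (huc.mul (continuous_regWeight_right hκ ε)).aestronglyMeasurable

lemma continuous_regQuot {ε : ℝ} (hε : 0 < ε) (α : EuclideanSpace ℝ (Fin d)) :
    Continuous fun x : EuclideanSpace ℝ (Fin d) => 2 * inner ℝ α x / (inner ℝ α x ^ 2 + ε) :=
  Continuous.div (by fun_prop) (by fun_prop) fun x => by positivity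

lemma polyBounded_regQuot {ε : ℝ} (hε : 0 < ε) (α : EuclideanSpace ℝ (Fin d)) :
    PolyBounded fun x => 2 * inner ℝ α x / (inner ℝ α x ^ 2 + ε) := by
  refine (((PolyBounded.const (2 / ε))).mul (polyBounded_inner α)).mono fun x => ?_
  rw [mul_div_right_comm, abs_mul, abs_mul]
  refine mul_le_mul_of_nonneg_right ?_ (abs_nonneg _)
  rw [abs_of_nonneg (by positivity), abs_of_nonneg (by positivity)]
  exact div_le_div_of_nonneg_left zero_le_two hε (by nlinarith [sq_nonneg (inner ℝ α x)])

lemma integrable_regQuot (hκ : ∀ α ∈ P, 0 ≤ κ α) {ε : ℝ} (hε : 0 < ε) (hε1 : ε ≤ 1)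
    (α : EuclideanSpace ℝ (Fin d)) (p : MvPolynomial (Fin d) ℝ) :
    Integrable fun x => polyFun p x * (2 * inner ℝ α x / (inner ℝ α x ^ 2 + ε)) *
      regWeight P κ ε x * gauss x :=
  integrable_regWeight hκ hε.le hε1 ((polyBounded_polyFun p).mul (polyBounded_regQuot hε α))
    ((contDiff_polyFun p).continuous.mul (continuous_regQuot hε α))

/-- Symmetrization under the reflection in `αᗮ`. -/
lemma integral_regQuot (hR : IsReducedRootSystem R) (hP : IsPositiveSystem R P)
    (hκ : IsMultiplicity R κ) {ε : ℝ} (hε : 0 < ε) (hε1 : ε ≤ 1) {α : EuclideanSpace ℝ (Fin d)}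
    (hα : α ∈ P) (p : MvPolynomial (Fin d) ℝ) :
    ∫ x, polyFun p x * (2 * inner ℝ α x / (inner ℝ α x ^ 2 + ε)) * regWeight P κ ε x * gauss x
      = ∫ x, diffQuot α (polyFun p) x *
          (inner ℝ α x ^ 2 / (inner ℝ α x ^ 2 + ε)) * regWeight P κ ε x * gauss x := by
  have hκ0 : ∀ α ∈ P, 0 ≤ κ α := fun α hα => hκ.nonneg α (hP.subset hα)
  have h1 := integral_comp_reflection α fun x => polyFun p x *
    (2 * inner ℝ α x / (inner ℝ α x ^ 2 + ε)) * regWeight P κ ε x * gauss x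
  have h4 := integrable_regQuot hκ0 hε hε1 α (reflPoly α p)
  simp only [inner_reflection (hP.ne_zero hR α hα), gauss_reflection, ← polyFun_reflPoly,
    regWeight_reflection hR hP hκ hα, neg_sq, mul_neg, neg_div, neg_mul, integral_neg] at h1
  have h2 := integral_sub (integrable_regQuot hκ0 hε hε1 α p) h4
  have h3 : ∀ x, diffQuot α (polyFun p) x *
        (inner ℝ α x ^ 2 / (inner ℝ α x ^ 2 + ε)) * regWeight P κ ε x * gauss x
      = (1 / 2) * (polyFun p x *
    (2 * inner ℝ α x / (inner ℝ α x ^ 2 + ε)) * regWeight P κ ε x * gauss x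
      - polyFun (reflPoly α p) x *
    (2 * inner ℝ α x / (inner ℝ α x ^ 2 + ε)) * regWeight P κ ε x * gauss x) := by
    intro x
    have := inner_mul_diffQuot α (polyFun p) x
    rw [polyFun_reflPoly]
    linear_combination (inner ℝ α x / (inner ℝ α x ^ 2 + ε) * regWeight P κ ε x * gauss x) * this
  simp only [h3]
  rw [integral_const_mul, h2]
  linarith

lemma fderiv_polyFun_mul_gauss (p : MvPolynomial (Fin d) ℝ) (j : Fin d)
    (x : EuclideanSpace ℝ (Fin d)) :
    fderiv ℝ (fun y => polyFun p y * gauss y) x (EuclideanSpace.single j 1)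
      = polyFun (pderiv j p - X j * p) x * gauss x := by
  rw [fderiv_fun_mul (differentiableAt_polyFun p x)
    (contDiff_gauss.differentiable (by simp)).differentiableAt]
  simp only [add_apply, smul_apply, smul_eq_mul, fderiv_gauss, fderiv_polyFun]
  simp [EuclideanSpace.inner_single_right]
  ring

/-- Integration by parts against the regularized weight. -/
lemma integral_regWeight_by_parts (hR : IsReducedRootSystem R) (hP : IsPositiveSystem R P)
    (hκ : IsMultiplicity R κ) {ε : ℝ} (hε : 0 < ε) (hε1 : ε ≤ 1) (j : Fin d)
    (p : MvPolynomial (Fin d) ℝ) :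
    ∑ α ∈ P, κ α * α j * ∫ x, diffQuot α (polyFun p) x *
          (inner ℝ α x ^ 2 / (inner ℝ α x ^ 2 + ε)) * regWeight P κ ε x * gauss x
      = - ∫ x, polyFun (pderiv j p - X j * p) x * regWeight P κ ε x * gauss x := by
  have hκ0 : ∀ α ∈ P, 0 ≤ κ α := fun α hα => hκ.nonneg α (hP.subset hα)
  have hI3 (α : EuclideanSpace ℝ (Fin d)) := integrable_regQuot (κ := κ) hκ0 hε hε1 α p
  have hf (x : EuclideanSpace ℝ (Fin d)) :
      fderiv ℝ (fun y => polyFun p y * gauss y) x (EuclideanSpace.single j 1) * regWeight P κ ε x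
        = polyFun (pderiv j p - X j * p) x * regWeight P κ ε x * gauss x := by
    rw [fderiv_polyFun_mul_gauss, mul_right_comm]
  have hg (x : EuclideanSpace ℝ (Fin d)) : polyFun p x * gauss x *
      fderiv ℝ (regWeight P κ ε) x (EuclideanSpace.single j 1)
      = ∑ α ∈ P, κ α * α j * (polyFun p x * (2 * inner ℝ α x / (inner ℝ α x ^ 2 + ε)) *
          regWeight P κ ε x * gauss x) := by
    obtain ⟨L, hL, hLξ⟩ := hasFDerivAt_regWeight (P := P) (κ := κ) hε x
    rw [hL.fderiv, hLξ, Finset.mul_sum, Finset.mul_sum]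
    refine Finset.sum_congr rfl fun α _ => ?_
    rw [EuclideanSpace.inner_single_right, conj_trivial]
    ring
  have hsum : Integrable fun x => ∑ α ∈ P, κ α * α j * (polyFun p x *
      (2 * inner ℝ α x / (inner ℝ α x ^ 2 + ε)) * regWeight P κ ε x * gauss x) :=
    integrable_finsetSum P fun α _ => (hI3 α).const_mul (κ α * α j)
  have hparts := integral_mul_fderiv_eq_neg_fderiv_mul_of_integrable (μ := volume)
    (f := fun y => polyFun p y * gauss y) (g := regWeight P κ ε) (v := EuclideanSpace.single j 1)
    (by
      simp only [hf]
      exact integrable_regWeight hκ0 hε.le hε1 (polyBounded_polyFun _)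
        (contDiff_polyFun _).continuous)
    (by
      simp only [hg]
      exact hsum)
    (by
      simp only [mul_right_comm _ (gauss _)]
      exact integrable_regWeight hκ0 hε.le hε1 (polyBounded_polyFun p)
        (contDiff_polyFun p).continuous)
    (fun x _ => (differentiableAt_polyFun p x).mul
      (contDiff_gauss.differentiable (by simp)).differentiableAt)
    (fun x _ => by
      obtain ⟨L, hL, -⟩ := hasFDerivAt_regWeight (P := P) (κ := κ) hε x
      exact hL.differentiableAt)
  simp only [hf, hg] at hparts
  rw [← hparts, integral_finsetSum P fun α _ => (hI3 α).const_mul (κ α * α j)]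
  refine Finset.sum_congr rfl fun α hα => ?_
  rw [integral_const_mul, integral_regQuot hR hP hκ hε hε1 hα]

variable (P κ) in
/-- The integral against the weighted Gaussian measure. -/
def gaussInt (p : MvPolynomial (Fin d) ℝ) : ℝ := ∫ x, polyFun p x * regWeight P κ 0 x * gauss x

lemma integrable_gaussInt (hκ : ∀ α ∈ P, 0 ≤ κ α) (p : MvPolynomial (Fin d) ℝ) :
    Integrable fun x => polyFun p x * regWeight P κ 0 x * gauss x :=
  ((polyBounded_polyFun p).mul (polyBounded_regWeight hκ le_rfl zero_le_one)).integrable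
    ((contDiff_polyFun p).continuous.mul (continuous_regWeight_right hκ 0)).aestronglyMeasurable

lemma gaussInt_add (hκ : ∀ α ∈ P, 0 ≤ κ α) (p q : MvPolynomial (Fin d) ℝ) :
    gaussInt P κ (p + q) = gaussInt P κ p + gaussInt P κ q := by
  rw [gaussInt, gaussInt, gaussInt,
    ← integral_add (integrable_gaussInt hκ p) (integrable_gaussInt hκ q)]
  simp only [polyFun_add, add_mul]

lemma gaussInt_smul (c : ℝ) (p : MvPolynomial (Fin d) ℝ) :
    gaussInt P κ (c • p) = c * gaussInt P κ p := by
  rw [gaussInt, gaussInt, ← integral_const_mul]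
  simp only [polyFun_smul, mul_assoc]

variable (P κ) in
/-- The integral against the weighted Gaussian measure as a linear functional. -/
def gaussLin (hκ : ∀ α ∈ P, 0 ≤ κ α) : MvPolynomial (Fin d) ℝ →ₗ[ℝ] ℝ where
  toFun := gaussInt P κ
  map_add' := gaussInt_add hκ
  map_smul' := gaussInt_smul

lemma gaussInt_reflPoly (hR : IsReducedRootSystem R) (hP : IsPositiveSystem R P)
    (hκ : IsMultiplicity R κ) {β : EuclideanSpace ℝ (Fin d)} (hβ : β ∈ P)
    (p : MvPolynomial (Fin d) ℝ) : gaussInt P κ (reflPoly β p) = gaussInt P κ p := by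
  have := integral_comp_reflection β fun x => polyFun p x * regWeight P κ 0 x * gauss x
  simp only [regWeight_reflection hR hP hκ hβ, gauss_reflection, ← polyFun_reflPoly] at this
  exact this

lemma gaussInt_dunklEnd (hR : IsReducedRootSystem R) (hP : IsPositiveSystem R P)
    (hκ : IsMultiplicity R κ) (j : Fin d) (p : MvPolynomial (Fin d) ℝ) :
    gaussInt P κ (dunklEnd P κ (EuclideanSpace.single j 1) p) = gaussInt P κ (X j * p) := by
  have hκ0 : ∀ α ∈ P, 0 ≤ κ α := fun α hα => hκ.nonneg α (hP.subset hα)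
  choose q hq using fun α => exists_polyFun_eq_diffQuot α p
  set ξ : EuclideanSpace ℝ (Fin d) := EuclideanSpace.single j 1 with hξ
  have hD : dunklEnd P κ ξ p
      = pderiv j p + ∑ α ∈ P, (κ α * α j) • q α := by
    apply polyFun_injective
    ext x
    simp only [polyFun_dunklEnd, polyFun_add, dunklOp, fderiv_polyFun, polyFun_sum, polyFun_smul,
      hq]
    simp [hξ, EuclideanSpace.inner_single_right]
  have h1 (u : MvPolynomial (Fin d) ℝ) : Tendsto
      (fun ε => ∫ x, polyFun u x * regWeight P κ ε x * gauss x) (𝓝[>] 0)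
      (𝓝 (gaussInt P κ u)) := by
    have := tendsto_integral_regWeight hκ0 (polyBounded_polyFun u) (contDiff_polyFun u).continuous
      (k := fun _ _ => 1) (fun _ _ => continuous_const) (fun _ _ _ => by simp)
      (Eventually.of_forall fun _ => tendsto_const_nhds)
    simpa [gaussInt] using this
  have h2 (α) (hα : α ∈ P) : Tendsto (fun ε => ∫ x, polyFun (q α) x *
      (inner ℝ α x ^ 2 / (inner ℝ α x ^ 2 + ε)) * regWeight P κ ε x * gauss x) (𝓝[>] 0)
      (𝓝 (gaussInt P κ (q α))) := by
    refine tendsto_integral_regWeight hκ0 (polyBounded_polyFun _) (contDiff_polyFun _).continuous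
      (fun ε hε => Continuous.div (by fun_prop) (by fun_prop) fun x => by positivity)
      (fun ε hε x => ?_) ?_
    · rw [abs_of_nonneg (by positivity)]
      exact div_le_one_of_le₀ (by linarith) (by positivity)
    · filter_upwards [ae_inner_ne_zero (hP.ne_zero hR α hα)] with x hx
      have h3 : inner ℝ α x ^ 2 ≠ 0 := pow_ne_zero 2 hx
      have h4 : Tendsto (fun ε : ℝ => inner ℝ α x ^ 2 / (inner ℝ α x ^ 2 + ε)) (𝓝 0)
          (𝓝 (inner ℝ α x ^ 2 / (inner ℝ α x ^ 2 + 0))) :=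
        tendsto_const_nhds.div (tendsto_const_nhds.add tendsto_id) (by simpa using h3)
      rw [add_zero, div_self h3] at h4
      exact h4.mono_left nhdsWithin_le_nhds
  have h3 := tendsto_finsetSum P fun α hα => (h2 α hα).const_mul (κ α * α j)
  have h4 := (h1 (pderiv j p - X j * p)).neg
  have h5 := tendsto_nhds_unique_of_eventuallyEq h3 h4 (by
    filter_upwards [Ioc_mem_nhdsGT (zero_lt_one' ℝ)] with ε hε
    simp only [hq]
    exact integral_regWeight_by_parts hR hP hκ hε.1 hε.2 j p)
  change ∑ α ∈ P, _ * gaussLin P κ hκ0 _ = - gaussLin P κ hκ0 _ at h5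
  change gaussLin P κ hκ0 _ = gaussLin P κ hκ0 _
  simp only [hD, map_add, map_sum, map_smul, smul_eq_mul, h5, map_sub]
  ring

end GaussInt

section Adjoint

variable {d : ℕ} {R P : Finset (EuclideanSpace ℝ (Fin d))} {κ : EuclideanSpace ℝ (Fin d) → ℝ}

/-- The Gaussian adjoint of `𝒟_j` is `x_j - 𝒟_j`. -/
lemma gaussInt_dunklEnd_mul (hR : IsReducedRootSystem R) (hP : IsPositiveSystem R P)
    (hκ : IsMultiplicity R κ) (j : Fin d) (u v : MvPolynomial (Fin d) ℝ) :
    gaussInt P κ (dunklEnd P κ (EuclideanSpace.single j 1) u * v)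
      = gaussInt P κ (u * (X j * v - dunklEnd P κ (EuclideanSpace.single j 1) v)) := by
  have hκ0 : ∀ α ∈ P, 0 ≤ κ α := fun α hα => hκ.nonneg α (hP.subset hα)
  choose qu hqu using fun α => exists_polyFun_eq_diffQuot α u
  choose qv hqv using fun α => exists_polyFun_eq_diffQuot α v
  set w : EuclideanSpace ℝ (Fin d) → MvPolynomial (Fin d) ℝ := fun α =>
    (∑ i, α i • X i) * (qu α * qv α) with hw
  have hl (α x : EuclideanSpace ℝ (Fin d)) :
      polyFun (∑ i, α i • (X i : MvPolynomial (Fin d) ℝ)) x = inner ℝ α x := by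
    simp [PiLp.inner_apply, mul_comm]
  have hD : dunklEnd P κ (EuclideanSpace.single j 1) (u * v)
      = dunklEnd P κ (EuclideanSpace.single j 1) u * v
        + u * dunklEnd P κ (EuclideanSpace.single j 1) v - ∑ α ∈ P, (κ α * α j) • w α := by
    apply polyFun_injective
    have huv : polyFun (u * v) = fun x => polyFun u x * polyFun v x := by ext x; simp
    ext x
    simp only [polyFun_sub, polyFun_add, polyFun_mul, polyFun_sum, polyFun_smul, polyFun_dunklEnd,
      huv, dunklOp, hw, hl, hqu, hqv,
      fderiv_fun_mul (differentiableAt_polyFun u x) (differentiableAt_polyFun v x),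
      diffQuot_mul (differentiableAt_polyFun u x) (differentiableAt_polyFun v x),
      add_apply, smul_apply, smul_eq_mul,
      EuclideanSpace.inner_single_right, conj_trivial, one_mul]
    rw [add_mul, mul_add, Finset.sum_mul, Finset.mul_sum, eq_sub_iff_add_eq, add_assoc,
      ← Finset.sum_add_distrib, add_add_add_comm, ← Finset.sum_add_distrib,
      add_comm (polyFun u x * _)]
    congr 1
    · ring
    · exact Finset.sum_congr rfl fun α _ => by ring
  have hw0 (α) (hα : α ∈ P) : gaussInt P κ (w α) = 0 := by
    have h0 := hP.ne_zero hR α hα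
    have h1 : reflPoly α (w α) = (-1 : ℝ) • w α := by
      apply polyFun_injective
      ext x
      simp only [polyFun_reflPoly, hw, polyFun_mul, polyFun_smul, hl, hqu, hqv,
        diffQuot_reflection h0, inner_reflection h0]
      ring
    have h2 := gaussInt_reflPoly hR hP hκ hα (w α)
    rw [h1, gaussInt_smul] at h2
    linarith
  have h := gaussInt_dunklEnd hR hP hκ j (u * v)
  rw [hD] at h
  change ∀ α ∈ P, gaussLin P κ hκ0 _ = 0 at hw0
  change gaussLin P κ hκ0 _ = gaussLin P κ hκ0 _ at h
  change gaussLin P κ hκ0 _ = gaussLin P κ hκ0 _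
  rw [map_sub, map_add, map_sum, Finset.sum_eq_zero fun α hα => by
    rw [map_smul, hw0 α hα, smul_zero]] at h
  rw [mul_sub, map_sub, mul_left_comm]
  linarith

lemma gaussInt_dunklEnd_pow_mul_heat (hR : IsReducedRootSystem R) (hP : IsPositiveSystem R P)
    (hκ : IsMultiplicity R κ) (j : Fin d) (n : ℕ) (p v : MvPolynomial (Fin d) ℝ) :
    gaussInt P κ ((dunklEnd P κ (EuclideanSpace.single j 1) ^ n) p * heat P κ v)
      = gaussInt P κ (p * heat P κ (X j ^ n * v)) := by
  induction n generalizing v with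
  | zero => simp
  | succ n ih =>
    rw [pow_succ', Module.End.mul_apply, gaussInt_dunklEnd_mul hR hP hκ, ← heat_X_mul hR hP hκ, ih,
      ← mul_assoc, ← pow_succ]

lemma gaussInt_dunklMonomialEnd (hR : IsReducedRootSystem R) (hP : IsPositiveSystem R P)
    (hκ : IsMultiplicity R κ) (s : Fin d →₀ ℕ) (p : MvPolynomial (Fin d) ℝ) :
    gaussInt P κ (dunklMonomialEnd P κ s p) = gaussInt P κ (p * heat P κ (monomial s 1)) := by
  have key (l : List (Fin d)) (v : MvPolynomial (Fin d) ℝ) : gaussInt P κ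
      ((l.map fun j => dunklEnd P κ (EuclideanSpace.single j 1) ^ s j).prod p * heat P κ v)
      = gaussInt P κ (p * heat P κ ((l.map fun j => X j ^ s j).prod * v)) := by
    induction l generalizing v with
    | nil => simp
    | cons j l ih =>
      rw [List.map_cons, List.prod_cons, Module.End.mul_apply,
        gaussInt_dunklEnd_pow_mul_heat hR hP hκ, ih, List.map_cons, List.prod_cons]
      congr 3
      ring
  have h := key (List.finRange d) 1
  rw [heat_one, mul_one, mul_one] at h
  rw [dunklMonomialEnd, h, monomial_eq, C_1, one_mul, Finsupp.prod_fintype _ _ (by simp),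
    ← List.ofFn_eq_map, List.prod_ofFn]

/-- For harmonic `q` the operator `q(𝒟)` is the Gaussian adjoint of the multiplication by `q`. -/
lemma gaussInt_dunklPolyEnd (hR : IsReducedRootSystem R) (hP : IsPositiveSystem R P)
    (hκ : IsMultiplicity R κ) {q : MvPolynomial (Fin d) ℝ} (hq : lapEnd P κ q = 0)
    (p : MvPolynomial (Fin d) ℝ) :
    gaussInt P κ (dunklPolyEnd P κ q p) = gaussInt P κ (q * p) := by
  have hκ0 : ∀ α ∈ P, 0 ≤ κ α := fun α hα => hκ.nonneg α (hP.subset hα)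
  have h0 := hP.ne_zero hR
  have h1 : ∑ s ∈ q.support, q.coeff s • heat P κ (monomial s 1) = q := by
    conv_rhs => rw [← heat_of_lapEnd_eq_zero hq, q.as_sum, heat_sum h0]
    refine Finset.sum_congr rfl fun s _ => ?_
    rw [← heat_smul h0, smul_monomial, smul_eq_mul, mul_one]
  have h2 : gaussInt P κ (dunklPolyEnd P κ q p)
      = ∑ s ∈ q.support, q.coeff s * gaussInt P κ (dunklMonomialEnd P κ s p) := by
    change gaussLin P κ hκ0 _ = ∑ s ∈ q.support, _ * gaussLin P κ hκ0 _
    simp [dunklPolyEnd, LinearMap.sum_apply]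
  rw [h2]
  conv_rhs => rw [← h1]
  simp only [gaussInt_dunklMonomialEnd hR hP hκ]
  change _ = gaussLin P κ hκ0 _
  rw [Finset.sum_mul, map_sum]
  refine Finset.sum_congr rfl fun s _ => ?_
  rw [smul_mul_assoc, map_smul, mul_comm p, smul_eq_mul]
  rfl

lemma gaussInt_lapEnd (hR : IsReducedRootSystem R) (hP : IsPositiveSystem R P)
    (hκ : IsMultiplicity R κ) {k : ℕ} {g : MvPolynomial (Fin d) ℝ} (hg : g.IsHomogeneous k) :
    gaussInt P κ (lapEnd P κ g) = k * gaussInt P κ g := by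
  have hκ0 : ∀ α ∈ P, 0 ≤ κ α := fun α hα => hκ.nonneg α (hP.subset hα)
  have h1 : gaussInt P κ (lapEnd P κ g)
      = gaussInt P κ (∑ j, X j * dunklEnd P κ (EuclideanSpace.single j 1) g) := by
    change gaussLin P κ hκ0 _ = gaussLin P κ hκ0 _
    rw [lapEnd_apply, map_sum, map_sum]
    exact Finset.sum_congr rfl fun j _ => gaussInt_dunklEnd hR hP hκ j _
  rw [h1, sum_X_mul_dunklEnd hg]
  change gaussLin P κ hκ0 _ = _ * gaussLin P κ hκ0 _
  rw [map_add, map_smul, map_sum, Finset.sum_eq_zero fun α hα => ?_, add_zero, smul_eq_mul]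
  have h2 : gaussLin P κ hκ0 (reflPoly α g) = gaussLin P κ hκ0 g :=
    gaussInt_reflPoly hR hP hκ hα g
  rw [map_smul, map_sub, h2, sub_self, smul_zero]

lemma gaussInt_lapEnd_pow (hR : IsReducedRootSystem R) (hP : IsPositiveSystem R P)
    (hκ : IsMultiplicity R κ) {n : ℕ} {g : MvPolynomial (Fin d) ℝ}
    (hg : g.IsHomogeneous (2 * n)) :
    gaussInt P κ ((lapEnd P κ ^ n) g) = 2 ^ n * n.factorial * gaussInt P κ g := by
  induction n generalizing g with
  | zero => simp
  | succ n ih =>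
    have h1 := (lowersDegree_lapEnd (κ := κ) (hP.ne_zero hR) _ g hg).1
    rw [show 2 * (n + 1) - 2 = 2 * n by omega] at h1
    rw [pow_succ, Module.End.mul_apply, ih h1, gaussInt_lapEnd hR hP hκ hg, Nat.factorial_succ]
    push_cast
    ring

lemma gaussInt_eq_zero_of_odd (hR : IsReducedRootSystem R) (hP : IsPositiveSystem R P)
    (hκ : IsMultiplicity R κ) {n : ℕ} {g : MvPolynomial (Fin d) ℝ}
    (hg : g.IsHomogeneous (2 * n + 1)) : gaussInt P κ g = 0 := by
  induction n generalizing g with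
  | zero =>
    have h1 := gaussInt_lapEnd hR hP hκ hg
    rw [(lowersDegree_lapEnd (κ := κ) (hP.ne_zero hR) _ g hg).2 (by omega)] at h1
    simpa [gaussInt] using h1.symm
  | succ n ih =>
    have h1 := (lowersDegree_lapEnd (κ := κ) (hP.ne_zero hR) _ g hg).1
    rw [show 2 * (n + 1) + 1 - 2 = 2 * n + 1 by omega] at h1
    have h2 := gaussInt_lapEnd hR hP hκ hg
    rw [ih h1] at h2
    have h3 : ((2 * (n + 1) + 1 : ℕ) : ℝ) ≠ 0 := by positivity
    exact (mul_eq_zero.1 h2.symm).resolve_left h3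

lemma eq_C_of_isHomogeneous_zero {p : MvPolynomial (Fin d) ℝ} (hp : p.IsHomogeneous 0) :
    p = C (polyFun p 0) := by
  obtain ⟨c, rfl⟩ : ∃ c, p = C c :=
    ⟨_, totalDegree_eq_zero_iff_eq_C.1 (Nat.le_zero.1 hp.totalDegree_le)⟩
  rw [polyFun_C]

lemma polyFun_zero_of_isHomogeneous {p : MvPolynomial (Fin d) ℝ} {k : ℕ} (hp : p.IsHomogeneous k)
    (hk : k ≠ 0) : polyFun p 0 = 0 := by
  have := hp.coeff_eq_zero (d := 0) (by simpa using hk.symm)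
  rw [← constantCoeff_eq] at this
  rw [← this, constantCoeff_eq]
  change eval (0 : Fin d → ℝ) p = _
  rw [eval_zero, constantCoeff_eq]

lemma gaussInt_C (c : ℝ) : gaussInt P κ (C c) = c * gaussInt P κ 1 := by
  rw [← gaussInt_smul, smul_eq_C_mul, mul_one]

/-- The Gaussian moments of a harmonic polynomial against a homogeneous polynomial. -/
lemma gaussInt_harmonic_mul (hR : IsReducedRootSystem R) (hP : IsPositiveSystem R P)
    (hκ : IsMultiplicity R κ) {m n : ℕ} {q p : MvPolynomial (Fin d) ℝ} (hqm : q.IsHomogeneous m)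
    (hq : lapEnd P κ q = 0) (hp : p.IsHomogeneous (m + 2 * n)) :
    2 ^ n * n.factorial * gaussInt P κ (q * p)
      = polyFun (dunklPolyEnd P κ q ((lapEnd P κ ^ n) p)) 0 * gaussInt P κ 1 := by
  have h0 := hP.ne_zero hR
  have h1 := (lowersDegree_dunklPolyEnd (κ := κ) h0 hqm _ p hp).1
  rw [Nat.add_sub_cancel_left] at h1
  have h2 := ((lowersDegree_lapEnd (κ := κ) h0).pow n _ _ h1).1
  rw [show 2 * n - n * 2 = 0 by omega] at h2
  have h3 := (commute_lapEnd_dunklPolyEnd hR hP hκ q).pow_left n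
  have h4 := LinearMap.congr_fun h3.eq p
  rw [Module.End.mul_apply, Module.End.mul_apply] at h4
  rw [← gaussInt_dunklPolyEnd hR hP hκ hq, ← gaussInt_lapEnd_pow hR hP hκ h1,
    eq_C_of_isHomogeneous_zero h2, gaussInt_C, h4]

lemma gaussInt_harmonic_mul_eq_zero (hR : IsReducedRootSystem R) (hP : IsPositiveSystem R P)
    (hκ : IsMultiplicity R κ) {m k : ℕ} {q p : MvPolynomial (Fin d) ℝ} (hqm : q.IsHomogeneous m)
    (hq : lapEnd P κ q = 0) (hp : p.IsHomogeneous k) (hk : ∀ n, k ≠ m + 2 * n) :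
    gaussInt P κ (q * p) = 0 := by
  have h0 := hP.ne_zero hR
  rw [← gaussInt_dunklPolyEnd hR hP hκ hq]
  obtain ⟨h1, h2⟩ := lowersDegree_dunklPolyEnd (κ := κ) h0 hqm _ p hp
  by_cases h : k < m
  · rw [h2 h]
    simp [gaussInt]
  · obtain ⟨n, hn | hn⟩ := Nat.even_or_odd' (k - m)
    · exact absurd (show k = m + 2 * n by omega) (hk n)
    · rw [hn] at h1
      exact gaussInt_eq_zero_of_odd hR hP hκ h1

end Adjoint

section Polar

variable {d : ℕ}

lemma polyFun_smul_arg {p : MvPolynomial (Fin d) ℝ} {k : ℕ} (hp : p.IsHomogeneous k) (r : ℝ)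
    (x : EuclideanSpace ℝ (Fin d)) : polyFun p (r • x) = r ^ k * polyFun p x := by
  rw [polyFun, polyFun, eval_eq', eval_eq', Finset.mul_sum]
  refine Finset.sum_congr rfl fun s hs => ?_
  have hsk : ∑ i, s i = k := by
    rw [← Finsupp.degree_eq_sum, Finsupp.degree_eq_weight_one]
    exact hp (mem_support_iff.1 hs)
  simp only [PiLp.smul_apply, smul_eq_mul, mul_pow, Finset.prod_mul_distrib,
    Finset.prod_pow_eq_pow_sum, hsk]
  ring

/-- Gaussian integration in polar coordinates. -/
lemma integral_mul_gauss_polar (hd : 0 < d) (F : EuclideanSpace ℝ (Fin d) → ℝ) (g : ℝ → ℝ)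
    (hF : ∀ r : ℝ, 0 < r → ∀ y, F (r • y) = g r * F y) :
    ∫ x, F x * gauss x = sphereIntegral F *
      ∫ r in Set.Ioi (0 : ℝ), r ^ (d - 1) * (g r * Real.exp (-r ^ 2 / 2)) := by
  calc ∫ x, F x * gauss x
      = ∫ x : ({(0)}ᶜ : Set (EuclideanSpace ℝ (Fin d))), F x * gauss x.1
          ∂((volume : Measure (EuclideanSpace ℝ (Fin d))).comap (↑)) := by
        rw [integral_subtype_comap (measurableSet_singleton _).compl fun x => F x * gauss x]
        have : Nontrivial (EuclideanSpace ℝ (Fin d)) := by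
          have : Nonempty (Fin d) := ⟨⟨0, hd⟩⟩
          infer_instance
        rw [restrict_compl_singleton]
    _ = ∫ z, F z.1 * (g z.2.1 * Real.exp (-z.2.1 ^ 2 / 2))
          ∂((volume : Measure (EuclideanSpace ℝ (Fin d))).toSphere.prod
            (.volumeIoiPow (Module.finrank ℝ (EuclideanSpace ℝ (Fin d)) - 1))) := by
        rw [← (Measure.measurePreserving_homeomorphUnitSphereProd
          (volume : Measure (EuclideanSpace ℝ (Fin d)))).integral_comp
          (Homeomorph.measurableEmbedding _)]
        refine integral_congr_ae (Eventually.of_forall fun x => ?_)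
        have hx : 0 < ‖x.1‖ := norm_pos_iff.2 x.2
        simp only [homeomorphUnitSphereProd_apply_fst_coe, homeomorphUnitSphereProd_apply_snd_coe]
        have h1 := hF ‖x.1‖ hx (‖x.1‖⁻¹ • x.1)
        rw [smul_inv_smul₀ hx.ne'] at h1
        rw [h1, gauss]
        ring
    _ = _ := by
        rw [integral_prod_mul (fun y : Metric.sphere (0 : EuclideanSpace ℝ (Fin d)) 1 => F y)
          (fun r : Set.Ioi (0 : ℝ) => g r.1 * Real.exp (-r.1 ^ 2 / 2)), sphereIntegral]
        congr 1
        simp only [Measure.volumeIoiPow, ENNReal.ofReal]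
        rw [integral_withDensity_eq_integral_smul, finrank_euclideanSpace_fin,
          integral_subtype_comap measurableSet_Ioi fun a : ℝ =>
            Real.toNNReal (a ^ (d - 1)) • (g a * Real.exp (-a ^ 2 / 2)),
          setIntegral_congr_fun measurableSet_Ioi fun x hx => ?_]
        · rw [NNReal.smul_def, Real.coe_toNNReal _ (pow_nonneg (le_of_lt hx) _), smul_eq_mul]
        · exact (measurable_subtype_coe.pow_const _).real_toNNReal

variable {P : Finset (EuclideanSpace ℝ (Fin d))} {κ : EuclideanSpace ℝ (Fin d) → ℝ}

lemma regWeight_smul {r : ℝ} (hr : 0 < r) (x : EuclideanSpace ℝ (Fin d)) :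
    regWeight P κ 0 (r • x) = r ^ (2 * ∑ α ∈ P, κ α) * regWeight P κ 0 x := by
  rw [regWeight, regWeight, Finset.mul_sum, Real.rpow_sum_of_pos hr, ← Finset.prod_mul_distrib]
  refine Finset.prod_congr rfl fun α _ => ?_
  rw [inner_smul_right, add_zero, add_zero, mul_pow, Real.mul_rpow (by positivity) (by positivity),
    Real.rpow_mul hr.le, Real.rpow_two]

/-- The radial factor of the Gaussian moments. -/
def radial (l k : ℝ) : ℝ :=
  (1 / 2 : ℝ) ^ (-(k / 2 + l + 1)) * (1 / 2) * Real.Gamma (k / 2 + l + 1)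

lemma radial_two_mul {l : ℝ} (hl : 0 < l + 1) (j : ℕ) :
    radial l (2 * j) = 2 ^ j * (ascPochhammer ℝ j).eval (l + 1) * radial l 0 := by
  induction j with
  | zero => simp
  | succ j ih =>
    have h1 : radial l (2 * (j + 1 : ℕ)) = 2 * (l + 1 + j) * radial l (2 * j) := by
      have h2 : l + 1 + j ≠ 0 := by positivity
      have h3 : 2 * ((j + 1 : ℕ) : ℝ) / 2 + l + 1 = l + 1 + j + 1 := by push_cast; ring
      have h4 : 2 * (j : ℝ) / 2 + l + 1 = l + 1 + j := by ring
      rw [radial, radial, h3, h4, Real.Gamma_add_one h2, neg_add, Real.rpow_add (by norm_num),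
        Real.rpow_neg (by norm_num) 1, Real.rpow_one]
      ring
    rw [h1, ih, ascPochhammer_succ_eval]
    ring

lemma lam_add_one_pos (hd : 0 < d) (hκ : ∀ α ∈ P, 0 ≤ κ α) : 0 < lam P κ + 1 := by
  have h1 : 0 ≤ ∑ α ∈ P, κ α := Finset.sum_nonneg hκ
  have h2 : (0 : ℝ) < d := Nat.cast_pos.2 hd
  rw [lam]
  linarith

lemma radial_zero_pos {l : ℝ} (hl : 0 < l + 1) : 0 < radial l 0 := by
  have := Real.Gamma_pos_of_pos hl
  rw [radial, zero_div, zero_add]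
  positivity

lemma gaussInt_eq_radial_mul (hd : 0 < d) (hκ : ∀ α ∈ P, 0 ≤ κ α) {k : ℕ}
    {p : MvPolynomial (Fin d) ℝ} (hp : p.IsHomogeneous k) :
    gaussInt P κ p
      = radial (lam P κ) k * sphereIntegral fun y => polyFun p y * weight P κ y ^ 2 := by
  have h1 := integral_mul_gauss_polar hd (fun y => polyFun p y * weight P κ y ^ 2)
    (fun r => r ^ k * r ^ (2 * ∑ α ∈ P, κ α)) fun r hr y => by
      rw [weight_sq, weight_sq, polyFun_smul_arg hp, regWeight_smul hr]
      ring
  simp only [weight_sq] at h1 ⊢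
  rw [gaussInt, h1, mul_comm]
  congr 1
  have h2 := integral_rpow_mul_exp_neg_mul_rpow (p := 2) (b := 1 / 2)
    (q := (k + d + 2 * ∑ α ∈ P, κ α) - 1) two_pos
    (by
      have h1 : 0 ≤ ∑ α ∈ P, κ α := Finset.sum_nonneg hκ
      have h2 : (0 : ℝ) < d := Nat.cast_pos.2 hd
      have h3 : (0 : ℝ) ≤ k := Nat.cast_nonneg k
      linarith) one_half_pos
  have h3 : ((k + d + 2 * ∑ α ∈ P, κ α) - 1 + 1) / 2 = k / 2 + lam P κ + 1 := by
    rw [lam]; ring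
  rw [neg_div, h3] at h2
  rw [radial, ← h2]
  refine setIntegral_congr_fun measurableSet_Ioi fun r hr => ?_
  have hr : 0 < r := hr
  have h4 : (k + d + 2 * ∑ α ∈ P, κ α) - 1 = ((d - 1 : ℕ) : ℝ) + k + 2 * ∑ α ∈ P, κ α := by
    rw [Nat.cast_pred hd]; ring
  rw [h4, Real.rpow_add hr, Real.rpow_add hr, Real.rpow_natCast, Real.rpow_natCast, Real.rpow_two]
  ring_nf

end Polar

section Mean

variable {d : ℕ} {R P : Finset (EuclideanSpace ℝ (Fin d))} {κ : EuclideanSpace ℝ (Fin d) → ℝ}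

lemma gaussInt_one_pos (hP : IsPositiveSystem R P) (hκ : ∀ α ∈ P, 0 ≤ κ α) :
    0 < gaussInt P κ 1 := by
  have h1 := integrable_gaussInt hκ 1
  have hc : Continuous fun x => polyFun 1 x * regWeight P κ 0 x * gauss x :=
    ((contDiff_polyFun 1).continuous.mul (continuous_regWeight_right hκ 0)).mul
      contDiff_gauss.continuous
  rw [gaussInt, integral_pos_iff_support_of_nonneg (fun x => ?_) h1]
  · refine hc.isOpen_support.measure_pos _ ?_
    obtain ⟨b, hb, hPb⟩ := hP
    refine ⟨b, ?_⟩
    have h2 : 0 < regWeight P κ 0 b := Finset.prod_pos fun α hα => by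
      have := ((hPb α).1 hα).2
      positivity
    rw [Function.mem_support, polyFun_one, one_mul]
    exact (mul_pos h2 (gauss_pos b)).ne'
  · rw [Pi.zero_apply, polyFun_one, one_mul]
    exact mul_nonneg (regWeight_nonneg le_rfl x) (gauss_pos x).le

lemma gaussInt_one_eq (hd : 0 < d) (hκ : ∀ α ∈ P, 0 ≤ κ α) :
    gaussInt P κ 1 = radial (lam P κ) 0 * omega P κ := by
  have := gaussInt_eq_radial_mul (P := P) hd hκ (isHomogeneous_one (Fin d) ℝ)
  simpa [omega] using this

lemma omega_ne_zero (hd : 0 < d) (hP : IsPositiveSystem R P) (hκ : ∀ α ∈ P, 0 ≤ κ α) :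
    omega P κ ≠ 0 := by
  intro h
  have := gaussInt_one_pos hP hκ
  rw [gaussInt_one_eq hd hκ, h, mul_zero] at this
  exact this.false

lemma sphericalMean_of_isHomogeneous (q : MvPolynomial (Fin d) ℝ) {p : MvPolynomial (Fin d) ℝ}
    {k : ℕ} (hp : p.IsHomogeneous k) (r : ℝ) : sphericalMean P κ q (polyFun p) r
      = r ^ k * (sphereIntegral (fun y => polyFun (q * p) y * weight P κ y ^ 2) / omega P κ) := by
  have : sphereIntegral (fun y => polyFun q y * polyFun p (r • y) * weight P κ y ^ 2)
      = r ^ k * sphereIntegral (fun y => polyFun (q * p) y * weight P κ y ^ 2) := by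
    rw [sphereIntegral, sphereIntegral, ← integral_const_mul]
    congr 1
    ext y
    rw [polyFun_smul_arg hp, polyFun_mul]
    ring
  rw [sphericalMean, this]
  ring

lemma polyFun_lapEnd_pow (n : ℕ) (p : MvPolynomial (Fin d) ℝ) :
    polyFun ((lapEnd P κ ^ n) p) = (dunklLaplacian P κ)^[n] (polyFun p) := by
  induction n with
  | zero => simp
  | succ n ih =>
    rw [pow_succ', Module.End.mul_apply, polyFun_lapEnd, ih, Function.iterate_succ_apply']

/-- Only the term of matching degree of the Pizzetti series of a homogeneous polynomial survives. -/
lemma pizzettiTerm_of_isHomogeneous (hP : ∀ α ∈ P, α ≠ 0) {m k : ℕ} {q p : MvPolynomial (Fin d) ℝ}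
    (hqm : q.IsHomogeneous m) (hp : p.IsHomogeneous k) (r : ℝ) {n : ℕ} (hk : k ≠ m + 2 * n) :
    pizzettiTerm P κ m q (polyFun p) r n = 0 := by
  have h := (lowersDegree_dunklPolyEnd (κ := κ) hP hqm).mul ((lowersDegree_lapEnd (κ := κ) hP).pow n) _ _ hp
  have h0 : polyFun ((dunklPolyEnd P κ q * lapEnd P κ ^ n) p) 0 = 0 := by
    by_cases hlt : k < m + n * 2
    · rw [h.2 hlt, polyFun_zero]
    · exact polyFun_zero_of_isHomogeneous h.1 (by omega)
  rw [Module.End.mul_apply, polyFun_dunklPolyEnd, polyFun_lapEnd_pow] at h0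
  rw [pizzettiTerm, h0, zero_div, zero_mul]

/-- Pizzetti's formula for homogeneous polynomials of degree `m + 2 n`. -/
lemma sphericalMean_eq_pizzettiTerm (hd : 0 < d) (hR : IsReducedRootSystem R)
    (hP : IsPositiveSystem R P) (hκ : IsMultiplicity R κ) {m n : ℕ} {q p : MvPolynomial (Fin d) ℝ}
    (hq : IsHomogeneousHarmonic P κ m q) (hp : p.IsHomogeneous (m + 2 * n)) (r : ℝ) :
    sphericalMean P κ q (polyFun p) r = pizzettiTerm P κ m q (polyFun p) r n := by
  have hκ0 : ∀ α ∈ P, 0 ≤ κ α := fun α hα => hκ.nonneg α (hP.subset hα)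
  have hq0 : lapEnd P κ q = 0 := polyFun_injective <| by
    ext x
    rw [polyFun_lapEnd, hq.2 x, polyFun_zero]
  have hl := lam_add_one_pos hd hκ0
  have h1 := gaussInt_harmonic_mul hR hP hκ hq.1 hq0 hp
  have h2 := gaussInt_eq_radial_mul (P := P) hd hκ0 (hq.1.mul hp)
  have h3 : ((m + (m + 2 * n) : ℕ) : ℝ) = 2 * (m + n : ℕ) := by push_cast; ring
  rw [h3, radial_two_mul hl] at h2
  rw [h2, gaussInt_one_eq hd hκ0, polyFun_dunklPolyEnd, polyFun_lapEnd_pow] at h1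
  rw [sphericalMean_of_isHomogeneous q hp, pizzettiTerm]
  have hω := omega_ne_zero hd hP hκ0
  have hr := (radial_zero_pos hl).ne'
  have hpoch := (ascPochhammer_pos (m + n) _ hl).ne'
  have hf : (n.factorial : ℝ) ≠ 0 := Nat.cast_ne_zero.2 n.factorial_ne_zero
  set S := sphereIntegral fun y => polyFun (q * p) y * weight P κ y ^ 2
  set A := dunklPoly P κ q ((dunklLaplacian P κ)^[n] (polyFun p)) 0
  set a := (ascPochhammer ℝ (m + n)).eval (lam P κ + 1)
  have h4 : 2 ^ (m + 2 * n) * n.factorial * a * S = A * omega P κ := by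
    apply mul_left_cancel₀ hr
    rw [show m + 2 * n = n + (m + n) by ring, pow_add]
    linear_combination h1
  rw [div_pow, div_mul_div_comm, eq_div_iff (by positivity), mul_div_assoc', div_mul_eq_mul_div,
    div_eq_iff hω]
  linear_combination r ^ (m + 2 * n) * h4

lemma sphericalMean_eq_zero (hd : 0 < d) (hR : IsReducedRootSystem R)
    (hP : IsPositiveSystem R P) (hκ : IsMultiplicity R κ) {m k : ℕ} {q p : MvPolynomial (Fin d) ℝ}
    (hq : IsHomogeneousHarmonic P κ m q) (hp : p.IsHomogeneous k) (hk : ∀ n, k ≠ m + 2 * n)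
    (r : ℝ) : sphericalMean P κ q (polyFun p) r = 0 := by
  have hκ0 : ∀ α ∈ P, 0 ≤ κ α := fun α hα => hκ.nonneg α (hP.subset hα)
  have hq0 : lapEnd P κ q = 0 := polyFun_injective <| by
    ext x
    rw [polyFun_lapEnd, hq.2 x, polyFun_zero]
  have hl := lam_add_one_pos hd hκ0
  have h1 := gaussInt_harmonic_mul_eq_zero hR hP hκ hq.1 hq0 hp hk
  have h2 := gaussInt_eq_radial_mul (P := P) hd hκ0 (hq.1.mul hp)
  have h3 : radial (lam P κ) ((m + k : ℕ) : ℝ) ≠ 0 := by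
    have : 0 < ((m + k : ℕ) : ℝ) / 2 + lam P κ + 1 := by
      have : (0 : ℝ) ≤ ((m + k : ℕ) : ℝ) := Nat.cast_nonneg _
      linarith
    have := Real.Gamma_pos_of_pos this
    rw [radial]
    positivity
  rw [h1, eq_comm, mul_eq_zero] at h2
  rw [sphericalMean_of_isHomogeneous q hp, h2.resolve_left h3, zero_div, mul_zero]

/-- Pizzetti's formula for homogeneous polynomials. -/
lemma sphericalMean_eq_sum_pizzettiTerm (hd : 0 < d) (hR : IsReducedRootSystem R)
    (hP : IsPositiveSystem R P) (hκ : IsMultiplicity R κ) {m k N : ℕ}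
    {q p : MvPolynomial (Fin d) ℝ} (hq : IsHomogeneousHarmonic P κ m q) (hp : p.IsHomogeneous k)
    (hk : k ≤ m + 2 * N) (r : ℝ) : sphericalMean P κ q (polyFun p) r
      = ∑ n ∈ Finset.range (N + 1), pizzettiTerm P κ m q (polyFun p) r n := by
  have h0 := hP.ne_zero hR
  by_cases h : ∃ n, k = m + 2 * n
  · obtain ⟨n, rfl⟩ := h
    rw [Finset.sum_eq_single n, sphericalMean_eq_pizzettiTerm hd hR hP hκ hq hp]
    · exact fun b _ hb => pizzettiTerm_of_isHomogeneous h0 hq.1 hp r (by omega)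
    · exact fun hn => absurd (Finset.mem_range.2 (by omega)) hn
  · push Not at h
    rw [sphericalMean_eq_zero hd hR hP hκ hq hp h, Finset.sum_eq_zero]
    exact fun n _ => pizzettiTerm_of_isHomogeneous h0 hq.1 hp r (h n)

end Mean

section Parametric

variable {E : Type*} [NormedAddCommGroup E] [NormedSpace ℝ E]

lemma hasFDerivAt_parametric_intervalIntegral [FiniteDimensional ℝ E] {g : E × ℝ → ℝ} (hg : ContDiff ℝ ∞ g) (x₀ : E) :
    HasFDerivAt (fun x => ∫ t in (0 : ℝ)..1, g (x, t))
      (∫ t in (0 : ℝ)..1, (fderiv ℝ g (x₀, t)).comp (ContinuousLinearMap.inl ℝ E ℝ)) x₀ := by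
  have hc : Continuous fun z : E × ℝ =>
      (fderiv ℝ g z).comp (ContinuousLinearMap.inl ℝ E ℝ) := by
    have h1 : Continuous (fderiv ℝ g) := hg.continuous_fderiv (by simp)
    exact h1.clm_comp continuous_const
  have hK : IsCompact (Metric.closedBall x₀ 1 ×ˢ Set.Icc (0 : ℝ) 1) :=
    (isCompact_closedBall x₀ 1).prod isCompact_Icc
  obtain ⟨C, hC⟩ := hK.exists_bound_of_continuousOn hc.continuousOn
  refine intervalIntegral.hasFDerivAt_integral_of_dominated_of_fderiv_le
    (F' := fun x t => (fderiv ℝ g (x, t)).comp (ContinuousLinearMap.inl ℝ E ℝ))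
    (s := Metric.closedBall x₀ 1) (bound := fun _ => C)
    (Metric.closedBall_mem_nhds x₀ one_pos) ?_ ?_ ?_ ?_ ?_ ?_
  · exact Eventually.of_forall fun x =>
      (hg.continuous.comp (Continuous.prodMk_right x)).aestronglyMeasurable
  · exact (hg.continuous.comp (Continuous.prodMk_right x₀)).intervalIntegrable _ _
  · exact (hc.comp (Continuous.prodMk_right x₀)).aestronglyMeasurable
  · refine Eventually.of_forall fun t ht x hx => hC (x, t) ⟨hx, ?_⟩
    rw [Set.uIoc_of_le zero_le_one] at ht
    exact Set.Ioc_subset_Icc_self ht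
  · exact intervalIntegrable_const
  · refine Eventually.of_forall fun t _ x _ => ?_
    have h1 : HasFDerivAt g (fderiv ℝ g (x, t)) (x, t) :=
      ((hg.differentiable (by simp)) (x, t)).hasFDerivAt
    exact h1.comp x (hasFDerivAt_prodMk_left x t)

lemma contDiff_parametric_intervalIntegral [FiniteDimensional ℝ E] {g : E × ℝ → ℝ} (hg : ContDiff ℝ ∞ g) :
    ContDiff ℝ ∞ fun x => ∫ t in (0 : ℝ)..1, g (x, t) := by
  rw [contDiff_infty]
  intro n
  induction n generalizing g with
  | zero =>
    rw [Nat.cast_zero, contDiff_zero]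
    exact intervalIntegral.continuous_parametric_intervalIntegral_of_continuous'
      (f := fun x t => g (x, t)) hg.continuous 0 1
  | succ n ih =>
    rw [Nat.cast_succ, contDiff_succ_iff_fderiv_apply]
    refine ⟨fun x => (hasFDerivAt_parametric_intervalIntegral hg x).differentiableAt,
      fun h => absurd h (by simp), fun y => ?_⟩
    have hc : Continuous fun z : E × ℝ =>
        (fderiv ℝ g z).comp (ContinuousLinearMap.inl ℝ E ℝ) := by
      have h1 : Continuous (fderiv ℝ g) := hg.continuous_fderiv (by simp)
      exact h1.clm_comp continuous_const
    have h1 (x : E) : fderiv ℝ (fun x => ∫ t in (0 : ℝ)..1, g (x, t)) x y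
        = ∫ t in (0 : ℝ)..1, fderiv ℝ g (x, t) (y, 0) := by
      rw [(hasFDerivAt_parametric_intervalIntegral hg x).fderiv,
        ContinuousLinearMap.intervalIntegral_apply (φ := fun t : ℝ =>
          (fderiv ℝ g (x, t)).comp (ContinuousLinearMap.inl ℝ E ℝ))
          ((hc.comp (Continuous.prodMk_right x)).intervalIntegrable _ _)]
      simp
    simp only [h1]
    have h2 : ContDiff ℝ ∞ fun z : E × ℝ => fderiv ℝ g z (y, 0) :=
      (hg.fderiv_right (m := ∞) (by simp)).clm_apply contDiff_const
    exact ih h2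

lemma sub_eq_intervalIntegral_fderiv {f : E → ℝ} (hf : ContDiff ℝ ∞ f) (x v : E) :
    f (x + v) - f x = ∫ t in (0 : ℝ)..1, fderiv ℝ f (x + t • v) v := by
  have h1 (t : ℝ) : HasDerivAt (fun t : ℝ => f (x + t • v)) (fderiv ℝ f (x + t • v) v) t := by
    have h2 : HasFDerivAt f (fderiv ℝ f (x + t • v)) (x + t • v) :=
      ((hf.differentiable (by simp)) _).hasFDerivAt
    have h3 : HasDerivAt (fun t : ℝ => x + t • v) v t := by
      simpa using ((hasDerivAt_id t).smul_const v).const_add x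
    exact h2.comp_hasDerivAt t h3
  have hc : Continuous fun t : ℝ => fderiv ℝ f (x + t • v) v := by
    have h1 : Continuous (fderiv ℝ f) := hf.continuous_fderiv (by simp)
    exact (h1.comp (by fun_prop)).clm_apply continuous_const
  rw [intervalIntegral.integral_eq_sub_of_hasDerivAt (fun t _ => h1 t)
    (hc.intervalIntegrable _ _)]
  simp

end Parametric

section Smooth

variable {d : ℕ} {P : Finset (EuclideanSpace ℝ (Fin d))} {κ : EuclideanSpace ℝ (Fin d) → ℝ}

lemma contDiff_diffQuot (α : EuclideanSpace ℝ (Fin d)) {f : EuclideanSpace ℝ (Fin d) → ℝ}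
    (hf : ContDiff ℝ ∞ f) : ContDiff ℝ ∞ (diffQuot α f) := by
  have h1 : diffQuot α f = fun x => 2 / ‖α‖ ^ 2 *
      ∫ t in (0 : ℝ)..1, fderiv ℝ f (x + t • (-(2 * inner ℝ α x / ‖α‖ ^ 2) • α)) α := by
    ext x
    by_cases h : inner ℝ α x = 0
    · simp [diffQuot, h]
    · have h2 := sub_eq_intervalIntegral_fderiv hf x (-(2 * inner ℝ α x / ‖α‖ ^ 2) • α)
      rw [show x + -(2 * inner ℝ α x / ‖α‖ ^ 2) • α = 𝔯 α x by
        rw [reflection_eq, neg_smul, sub_eq_add_neg]] at h2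
      simp only [map_smul, smul_eq_mul, intervalIntegral.integral_const_mul] at h2
      rw [diffQuot, if_neg h, div_eq_iff h]
      linear_combination -h2
  rw [h1]
  refine contDiff_const.mul (contDiff_parametric_intervalIntegral (g := fun z =>
    fderiv ℝ f (z.1 + z.2 • (-(2 * inner ℝ α z.1 / ‖α‖ ^ 2) • α)) α) ?_)
  refine ((hf.fderiv_right (m := ∞) (by simp)).comp ?_).clm_apply contDiff_const
  have h2 : ContDiff ℝ ∞ fun z : EuclideanSpace ℝ (Fin d) × ℝ => inner ℝ α z.1 :=
    contDiff_const.inner ℝ contDiff_fst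
  exact contDiff_fst.add (contDiff_snd.smul
    (((contDiff_const.mul h2).div_const _).neg.smul contDiff_const))

lemma contDiff_dunklOp (ξ : EuclideanSpace ℝ (Fin d)) {f : EuclideanSpace ℝ (Fin d) → ℝ}
    (hf : ContDiff ℝ ∞ f) : ContDiff ℝ ∞ (dunklOp P κ ξ f) :=
  ((hf.fderiv_right (m := ∞) (by simp)).clm_apply contDiff_const).add
    (ContDiff.sum fun α _ => contDiff_const.mul (contDiff_diffQuot α hf))

lemma dunklOp_congr {ξ : EuclideanSpace ℝ (Fin d)} {f g : EuclideanSpace ℝ (Fin d) → ℝ}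
    (h : f =ᶠ[𝓝 0] g) : dunklOp P κ ξ f =ᶠ[𝓝 0] dunklOp P κ ξ g := by
  have h1 : ∀ᶠ x in 𝓝 (0 : EuclideanSpace ℝ (Fin d)), ∀ α ∈ P, f (𝔯 α x) = g (𝔯 α x) := by
    rw [Filter.eventually_all_finset]
    intro α _
    have : Tendsto (𝔯 α) (𝓝 0) (𝓝 0) := by
      simpa using (𝔯 α).continuous.tendsto 0
    exact this.eventually h
  filter_upwards [h.eventually_nhds, h1] with x hx hx1
  rw [dunklOp, dunklOp, EventuallyEq.fderiv_eq hx]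
  congr 1
  refine Finset.sum_congr rfl fun α hα => ?_
  rw [diffQuot, diffQuot, EventuallyEq.fderiv_eq hx, hx.self_of_nhds, hx1 α hα]

/-- Smooth functions in the `k`-th power of the ideal generated by the coordinates. -/
def Flat : ℕ → (EuclideanSpace ℝ (Fin d) → ℝ) → Prop
  | 0, f => ContDiff ℝ ∞ f
  | k + 1, f => ∃ g : Fin d → EuclideanSpace ℝ (Fin d) → ℝ, (∀ i, Flat k (g i)) ∧
      f = fun x => ∑ i, x i * g i x

lemma Flat.contDiff {k : ℕ} {f : EuclideanSpace ℝ (Fin d) → ℝ} (hf : Flat k f) :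
    ContDiff ℝ ∞ f := by
  induction k generalizing f with
  | zero => exact hf
  | succ k ih =>
    obtain ⟨g, hg, rfl⟩ := hf
    exact ContDiff.sum fun i _ => (contDiff_coord i).mul (ih (hg i))

lemma Flat.add {k : ℕ} {f g : EuclideanSpace ℝ (Fin d) → ℝ} (hf : Flat k f) (hg : Flat k g) :
    Flat k fun x => f x + g x := by
  induction k generalizing f g with
  | zero => exact ContDiff.add hf hg
  | succ k ih =>
    obtain ⟨u, hu, rfl⟩ := hf
    obtain ⟨v, hv, rfl⟩ := hg
    refine ⟨fun i x => u i x + v i x, fun i => ih (hu i) (hv i), ?_⟩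
    simp only [mul_add, Finset.sum_add_distrib]

lemma Flat.const_mul {k : ℕ} {f : EuclideanSpace ℝ (Fin d) → ℝ} (hf : Flat k f) (c : ℝ) :
    Flat k fun x => c * f x := by
  induction k generalizing f with
  | zero => exact ContDiff.mul contDiff_const hf
  | succ k ih =>
    obtain ⟨u, hu, rfl⟩ := hf
    refine ⟨fun i x => c * u i x, fun i => ih (hu i), ?_⟩
    ext x
    rw [Finset.mul_sum]
    exact Finset.sum_congr rfl fun i _ => by ring

lemma Flat.zero (k : ℕ) : Flat k fun _ : EuclideanSpace ℝ (Fin d) => (0 : ℝ) := by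
  induction k with
  | zero => exact contDiff_const
  | succ k ih => exact ⟨fun _ _ => 0, fun _ => ih, by simp⟩

lemma Flat.sum {k : ℕ} {ι : Type*} (s : Finset ι) {f : ι → EuclideanSpace ℝ (Fin d) → ℝ}
    (hf : ∀ i ∈ s, Flat k (f i)) : Flat k fun x => ∑ i ∈ s, f i x := by
  classical
  induction s using Finset.induction_on with
  | empty => simpa using Flat.zero k
  | insert i s hi ih =>
    simp only [Finset.sum_insert hi]
    exact (hf i (Finset.mem_insert_self i s)).add
      (ih fun j hj => hf j (Finset.mem_insert_of_mem hj))

lemma Flat.coord_mul {k : ℕ} {f : EuclideanSpace ℝ (Fin d) → ℝ} (hf : Flat k f) (j : Fin d) :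
    Flat (k + 1) fun x => x j * f x := by
  refine ⟨fun i => if i = j then f else fun _ => 0, fun i => ?_, ?_⟩
  · change Flat k (if i = j then f else fun _ => 0)
    split_ifs
    exacts [hf, Flat.zero k]
  · ext x
    rw [Finset.sum_eq_single j (fun b _ hb => by simp [hb]) (by simp)]
    simp

lemma Flat.comp_reflection {k : ℕ} {f : EuclideanSpace ℝ (Fin d) → ℝ} (hf : Flat k f)
    (α : EuclideanSpace ℝ (Fin d)) : Flat k fun x => f (𝔯 α x) := by
  induction k generalizing f with
  | zero => exact ContDiff.comp hf (𝔯 α).toContinuousLinearEquiv.contDiff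
  | succ k ih =>
    obtain ⟨u, hu, rfl⟩ := hf
    have h1 : (fun x => ∑ i, (𝔯 α x) i * u i (𝔯 α x)) = fun x => ∑ i, (x i * u i (𝔯 α x)
        + ∑ l, x l * (-(2 / ‖α‖ ^ 2) * α l * α i * u i (𝔯 α x))) := by
      ext x
      refine Finset.sum_congr rfl fun i _ => ?_
      have h2 : (𝔯 α x) i = x i - 2 / ‖α‖ ^ 2 * (∑ l, x l * α l) * α i := by
        rw [reflection_eq]
        simp only [PiLp.sub_apply, PiLp.smul_apply, smul_eq_mul, PiLp.inner_apply,
          RCLike.inner_apply, conj_trivial]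
        ring
      rw [h2, sub_mul, sub_eq_add_neg, Finset.mul_sum, Finset.sum_mul, Finset.sum_mul,
        ← Finset.sum_neg_distrib]
      congr 1
      exact Finset.sum_congr rfl fun l _ => by ring
    change Flat (k + 1) (fun x => ∑ i, (𝔯 α x) i * u i (𝔯 α x))
    rw [h1]
    refine Flat.sum _ fun i _ => ((ih (hu i)).coord_mul i).add (Flat.sum _ fun l _ => ?_)
    exact ((ih (hu i)).const_mul _).coord_mul l

lemma dunklOp_sum_fun {ι : Type*} (s : Finset ι) {f : ι → EuclideanSpace ℝ (Fin d) → ℝ}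
    (hf : ∀ i ∈ s, ContDiff ℝ ∞ (f i)) (ξ x : EuclideanSpace ℝ (Fin d)) :
    dunklOp P κ ξ (fun y => ∑ i ∈ s, f i y) x = ∑ i ∈ s, dunklOp P κ ξ (f i) x := by
  classical
  induction s using Finset.induction_on with
  | empty => simp [dunklOp_const]
  | insert i s hi ih =>
    have h1 := hf i (Finset.mem_insert_self i s)
    have h2 := fun j hj => hf j (Finset.mem_insert_of_mem hj)
    simp only [Finset.sum_insert hi]
    rw [dunklOp_add_fun ((h1.differentiable (by simp)) x)
      (((ContDiff.sum h2).differentiable (by simp)) x), ih h2]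

lemma Flat.dunklOp (hP : ∀ α ∈ P, α ≠ 0) (ξ : EuclideanSpace ℝ (Fin d)) {k : ℕ}
    {f : EuclideanSpace ℝ (Fin d) → ℝ} (hf : Flat (k + 1) f) : Flat k (dunklOp P κ ξ f) := by
  induction k generalizing f with
  | zero => exact contDiff_dunklOp ξ hf.contDiff
  | succ k ih =>
    obtain ⟨g, hg, rfl⟩ := hf
    have h1 : Dunkl.dunklOp P κ ξ (fun x => ∑ i, x i * g i x)
        = fun x => ∑ i, (x i * Dunkl.dunklOp P κ ξ (g i) x + ξ i * g i x
          + ∑ α ∈ P, 2 * κ α * inner ℝ α ξ / ‖α‖ ^ 2 * α i * g i (𝔯 α x)) := by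
      ext x
      rw [dunklOp_sum_fun _ fun i _ => (contDiff_coord i).mul (hg i).contDiff]
      refine Finset.sum_congr rfl fun i _ => ?_
      rw [dunklOp_coord_mul hP i (((hg i).contDiff.differentiable (by simp)) x)]
    rw [h1]
    exact Flat.sum _ fun i _ => (((ih (hg i)).coord_mul i).add ((hg i).const_mul _)).add
      (Flat.sum _ fun α _ => ((hg i).comp_reflection α).const_mul _)

lemma Flat.apply_zero {k : ℕ} {f : EuclideanSpace ℝ (Fin d) → ℝ} (hf : Flat (k + 1) f) :
    f 0 = 0 := by
  obtain ⟨g, -, rfl⟩ := hf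
  simp

lemma Flat.isBigO {k : ℕ} {f : EuclideanSpace ℝ (Fin d) → ℝ} (hf : Flat k f) :
    f =O[𝓝 0] fun x => ‖x‖ ^ k := by
  induction k generalizing f with
  | zero =>
    simp only [pow_zero]
    exact (hf.contDiff.continuous.tendsto 0).isBigO_one ℝ
  | succ k ih =>
    obtain ⟨g, hg, rfl⟩ := hf
    have h1 (i : Fin d) : (fun x : EuclideanSpace ℝ (Fin d) => x i) =O[𝓝 0] fun x => ‖x‖ := by
      refine IsBigO.of_bound 1 (Eventually.of_forall fun x => ?_)
      rw [one_mul, norm_norm]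
      exact PiLp.norm_apply_le x i
    have h2 (i : Fin d) : (fun x : EuclideanSpace ℝ (Fin d) => x i * g i x)
        =O[𝓝 0] fun x => ‖x‖ ^ (k + 1) := by
      simp only [pow_succ']
      exact (h1 i).mul (ih (hg i))
    exact IsBigO.fun_sum fun i _ => h2 i

/-- Hadamard's lemma. -/
lemma exists_hadamard {f : EuclideanSpace ℝ (Fin d) → ℝ} (hf : ContDiff ℝ ∞ f) :
    ∃ g : Fin d → EuclideanSpace ℝ (Fin d) → ℝ, (∀ i, ContDiff ℝ ∞ (g i)) ∧
      ∀ x, f x = f 0 + ∑ i, x i * g i x := by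
  refine ⟨fun i x => ∫ t in (0 : ℝ)..1, fderiv ℝ f (t • x) (EuclideanSpace.single i 1),
    fun i => contDiff_parametric_intervalIntegral
      (g := fun z => fderiv ℝ f (z.2 • z.1) (EuclideanSpace.single i 1)) ?_, fun x => ?_⟩
  · exact ((hf.fderiv_right (m := ∞) (by simp)).comp (by fun_prop)).clm_apply contDiff_const
  · have h1 := sub_eq_intervalIntegral_fderiv hf 0 x
    simp only [zero_add] at h1
    have hx : x = ∑ i, x i • EuclideanSpace.single i (1 : ℝ) := by
      ext k
      simp [Finset.sum_apply, Pi.single_apply]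
    have h2 (t : ℝ) : fderiv ℝ f (t • x) x
        = ∑ i, x i * fderiv ℝ f (t • x) (EuclideanSpace.single i 1) := by
      have h3 := congrArg (fderiv ℝ f (t • x)) hx
      rw [map_sum] at h3
      simpa using h3
    have hc (i : Fin d) : Continuous fun t : ℝ =>
        x i * fderiv ℝ f (t • x) (EuclideanSpace.single i 1) := by
      have h1 : Continuous (fderiv ℝ f) := hf.continuous_fderiv (by simp)
      exact continuous_const.mul ((h1.comp (by fun_prop)).clm_apply continuous_const)
    simp only [h2] at h1
    rw [intervalIntegral.integral_finsetSum fun i _ => (hc i).intervalIntegrable _ _] at h1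
    simp only [intervalIntegral.integral_const_mul] at h1
    linarith

/-- Taylor's formula with flat remainder. -/
lemma exists_taylor (M : ℕ) {f : EuclideanSpace ℝ (Fin d) → ℝ} (hf : ContDiff ℝ ∞ f) :
    ∃ (p : ℕ → MvPolynomial (Fin d) ℝ) (g : EuclideanSpace ℝ (Fin d) → ℝ),
      (∀ k, (p k).IsHomogeneous k) ∧ Flat M g ∧
        f = fun x => ∑ k ∈ Finset.range M, polyFun (p k) x + g x := by
  induction M generalizing f with
  | zero => exact ⟨fun _ => 0, f, fun k => isHomogeneous_zero _ _ _, hf, by simp⟩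
  | succ M ih =>
    obtain ⟨g, hg, hfg⟩ := exists_hadamard hf
    choose p h hp hh hgp using fun i => ih (hg i)
    refine ⟨fun k => Nat.casesOn k (C (f 0)) fun k => ∑ i, X i * p i k,
      fun x => ∑ i, x i * h i x, fun k => ?_, ⟨h, hh, rfl⟩, ?_⟩
    · cases k with
      | zero => exact isHomogeneous_C _ _
      | succ k =>
        refine IsHomogeneous.sum _ _ _ fun i _ => ?_
        rw [add_comm]
        exact (isHomogeneous_X ℝ i).mul (hp i k)
    · ext x
      rw [hfg, Finset.sum_range_succ']
      have h1 : ∑ i, x i * g i x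
          = ∑ k ∈ Finset.range M, polyFun (∑ i, X i * p i k) x + ∑ i, x i * h i x := by
        simp only [polyFun_sum, polyFun_mul, polyFun_X]
        rw [Finset.sum_comm, ← Finset.sum_add_distrib]
        refine Finset.sum_congr rfl fun i _ => ?_
        rw [congrFun (hgp i) x, mul_add, Finset.mul_sum]
      rw [h1]
      change _ = ∑ k ∈ Finset.range M, polyFun (∑ i, X i * p i k) x + polyFun (C (f 0)) x
        + ∑ i, x i * h i x
      rw [polyFun_C]
      ring

lemma exists_contDiff_eventuallyEq {f : EuclideanSpace ℝ (Fin d) → ℝ}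
    {U : Set (EuclideanSpace ℝ (Fin d))} (hU : IsOpen U) (h0 : 0 ∈ U) (hf : ContDiffOn ℝ ∞ f U) :
    ∃ F : EuclideanSpace ℝ (Fin d) → ℝ, ContDiff ℝ ∞ F ∧ F =ᶠ[𝓝 0] f := by
  obtain ⟨ε, hε, hεU⟩ := Metric.nhds_basis_closedBall.mem_iff.1 (hU.mem_nhds h0)
  let b : ContDiffBump (0 : EuclideanSpace ℝ (Fin d)) := ⟨ε / 2, ε, half_pos hε, half_lt_self hε⟩
  refine ⟨fun x => b x * f x, contDiff_iff_contDiffAt.2 fun x => ?_, ?_⟩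
  · by_cases hx : x ∈ U
    · exact b.contDiff.contDiffAt.mul (hf.contDiffAt (hU.mem_nhds hx))
    · have h1 : x ∉ tsupport b := by
        rw [b.tsupport_eq]
        exact fun h => hx (hεU h)
      have h2 : (fun x => b x * f x) =ᶠ[𝓝 x] fun _ => 0 := by
        filter_upwards [notMem_tsupport_iff_eventuallyEq.1 h1] with y hy
        rw [hy, Pi.zero_apply, zero_mul]
      exact contDiffAt_const.congr_of_eventuallyEq h2
  · filter_upwards [b.eventuallyEq_one] with y hy
    rw [hy, Pi.one_apply, one_mul]

end Smooth

section RegularOp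

variable {d : ℕ} {P : Finset (EuclideanSpace ℝ (Fin d))} {κ : EuclideanSpace ℝ (Fin d) → ℝ}

/-- Local operators that act linearly on smooth functions and lower the order of vanishing at the
origin by at most `a`. -/
structure RegularOp (T : (EuclideanSpace ℝ (Fin d) → ℝ) → EuclideanSpace ℝ (Fin d) → ℝ)
    (a : ℕ) : Prop where
  contDiff : ∀ f, ContDiff ℝ ∞ f → ContDiff ℝ ∞ (T f)
  map_add : ∀ f g, ContDiff ℝ ∞ f → ContDiff ℝ ∞ g →
    T (fun x => f x + g x) = fun x => T f x + T g x
  flat : ∀ k f, Flat (k + a) f → Flat k (T f)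
  congr : ∀ f g, f =ᶠ[𝓝 0] g → T f =ᶠ[𝓝 0] T g

lemma RegularOp.id : RegularOp (d := d) id 0 :=
  ⟨fun _ h => h, fun _ _ _ _ => rfl, fun _ _ h => h, fun _ _ h => h⟩

lemma RegularOp.comp {S T : (EuclideanSpace ℝ (Fin d) → ℝ) → EuclideanSpace ℝ (Fin d) → ℝ}
    {a b : ℕ} (hS : RegularOp S a) (hT : RegularOp T b) :
    RegularOp (fun f => S (T f)) (a + b) where
  contDiff f hf := hS.contDiff _ (hT.contDiff f hf)
  map_add f g hf hg := by
    rw [hT.map_add f g hf hg, hS.map_add _ _ (hT.contDiff f hf) (hT.contDiff g hg)]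
  flat k f hf := hS.flat k _ (hT.flat (k + a) f (by rwa [add_assoc]))
  congr f g h := hS.congr _ _ (hT.congr f g h)

lemma RegularOp.iterate {T : (EuclideanSpace ℝ (Fin d) → ℝ) → EuclideanSpace ℝ (Fin d) → ℝ}
    {a : ℕ} (hT : RegularOp T a) (n : ℕ) : RegularOp T^[n] (n * a) := by
  induction n with
  | zero => simpa using RegularOp.id
  | succ n ih =>
    rw [add_mul, one_mul]
    exact ih.comp hT

lemma RegularOp.sum {ι : Type*} (s : Finset ι)
    {T : ι → (EuclideanSpace ℝ (Fin d) → ℝ) → EuclideanSpace ℝ (Fin d) → ℝ} {a : ℕ} (c : ι → ℝ)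
    (hT : ∀ i ∈ s, RegularOp (T i) a) : RegularOp (fun f x => ∑ i ∈ s, c i * T i f x) a where
  contDiff f hf := ContDiff.sum fun i hi => contDiff_const.mul ((hT i hi).contDiff f hf)
  map_add f g hf hg := by
    ext x
    rw [← Finset.sum_add_distrib]
    exact Finset.sum_congr rfl fun i hi => by rw [(hT i hi).map_add f g hf hg, mul_add]
  flat k f hf := Flat.sum s fun i hi => ((hT i hi).flat k f hf).const_mul (c i)
  congr f g h := by
    have : ∀ᶠ x in 𝓝 (0 : EuclideanSpace ℝ (Fin d)), ∀ i ∈ s, T i f x = T i g x := by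
      rw [Filter.eventually_all_finset]
      exact fun i hi => (hT i hi).congr f g h
    filter_upwards [this] with x hx
    exact Finset.sum_congr rfl fun i hi => by rw [hx i hi]

lemma RegularOp.map_sum {T : (EuclideanSpace ℝ (Fin d) → ℝ) → EuclideanSpace ℝ (Fin d) → ℝ}
    {a : ℕ} (hT : RegularOp T a) {ι : Type*} (s : Finset ι)
    {f : ι → EuclideanSpace ℝ (Fin d) → ℝ} (hf : ∀ i ∈ s, ContDiff ℝ ∞ (f i)) :
    T (fun x => ∑ i ∈ s, f i x) = fun x => ∑ i ∈ s, T (f i) x := by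
  classical
  induction s using Finset.induction_on with
  | empty =>
    have h := hT.map_add (fun _ => 0) (fun _ => 0) contDiff_const contDiff_const
    simp only [add_zero] at h
    ext x
    simp only [Finset.sum_empty]
    have := congrFun h x
    linarith
  | insert i s hi ih =>
    have h2 := fun j hj => hf j (Finset.mem_insert_of_mem hj)
    simp only [Finset.sum_insert hi]
    rw [hT.map_add _ _ (hf i (Finset.mem_insert_self i s)) (ContDiff.sum h2), ih h2]

lemma regularOp_dunklPartial (hP : ∀ α ∈ P, α ≠ 0) (j : Fin d) :
    RegularOp (dunklPartial P κ j) 1 where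
  contDiff f hf := contDiff_dunklOp _ hf
  map_add f g hf hg := funext fun x => dunklOp_add_fun ((hf.differentiable (by simp)) x)
    ((hg.differentiable (by simp)) x)
  flat k f hf := hf.dunklOp hP _
  congr f g h := dunklOp_congr h

lemma regularOp_dunklLaplacian (hP : ∀ α ∈ P, α ≠ 0) : RegularOp (dunklLaplacian P κ) 2 := by
  have := RegularOp.sum Finset.univ (fun _ => 1) fun (j : Fin d) _ =>
    (regularOp_dunklPartial (κ := κ) hP j).comp
      (regularOp_dunklPartial (κ := κ) hP j)
  simp only [one_mul] at this
  exact this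

lemma regularOp_dunklMonomial (hP : ∀ α ∈ P, α ≠ 0) (s : Fin d →₀ ℕ) :
    RegularOp (dunklMonomial P κ s) s.degree := by
  have key (l : List (Fin d)) : RegularOp
      (fun f => l.foldr (fun j g => (dunklPartial P κ j)^[s j] g) f)
      ((l.map fun j => s j).sum) := by
    induction l with
    | nil => exact RegularOp.id
    | cons j l ih =>
      have := ((regularOp_dunklPartial (κ := κ) hP j).iterate (s j)).comp ih
      rw [mul_one] at this
      exact this
  have h := key (List.finRange d)
  rw [← List.ofFn_eq_map, List.sum_ofFn, ← Finsupp.degree_eq_sum] at h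
  exact h

lemma regularOp_dunklPoly (hP : ∀ α ∈ P, α ≠ 0) {q : MvPolynomial (Fin d) ℝ} {m : ℕ}
    (hq : q.IsHomogeneous m) : RegularOp (dunklPoly P κ q) m := by
  refine RegularOp.sum q.support (fun s => q.coeff s) fun s hs => ?_
  have : s.degree = m := by
    rw [Finsupp.degree_eq_weight_one]
    exact hq (mem_support_iff.1 hs)
  exact this ▸ regularOp_dunklMonomial hP s

lemma regularOp_dunklPoly_iterate (hP : ∀ α ∈ P, α ≠ 0) {q : MvPolynomial (Fin d) ℝ} {m : ℕ}
    (hq : q.IsHomogeneous m) (n : ℕ) :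
    RegularOp (fun f => dunklPoly P κ q ((dunklLaplacian P κ)^[n] f)) (m + n * 2) :=
  (regularOp_dunklPoly hP hq).comp ((regularOp_dunklLaplacian hP).iterate n)

end RegularOp

section SphericalMean

variable {d : ℕ} {P : Finset (EuclideanSpace ℝ (Fin d))} {κ : EuclideanSpace ℝ (Fin d) → ℝ}
  {q : MvPolynomial (Fin d) ℝ}

lemma continuous_weight_sq (hκ : ∀ α ∈ P, 0 ≤ κ α) : Continuous fun x => weight P κ x ^ 2 := by
  simp only [weight_sq]
  exact continuous_regWeight_right hκ 0

lemma integrable_sphere {u : EuclideanSpace ℝ (Fin d) → ℝ} (hu : Continuous u) :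
    Integrable (fun y : Metric.sphere (0 : EuclideanSpace ℝ (Fin d)) 1 => u y)
      (volume : Measure (EuclideanSpace ℝ (Fin d))).toSphere :=
  (hu.comp continuous_subtype_val).integrable_of_hasCompactSupport
    (HasCompactSupport.of_compactSpace _)

lemma continuous_sphericalMean_integrand (hκ : ∀ α ∈ P, 0 ≤ κ α)
    {u : EuclideanSpace ℝ (Fin d) → ℝ} (hu : Continuous u) (r : ℝ) :
    Continuous fun y => polyFun q y * u (r • y) * weight P κ y ^ 2 :=
  ((contDiff_polyFun q).continuous.mul (hu.comp (continuous_const_smul r))).mul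
    (continuous_weight_sq hκ)

lemma sphericalMean_add (hκ : ∀ α ∈ P, 0 ≤ κ α) {u v : EuclideanSpace ℝ (Fin d) → ℝ}
    (hu : Continuous u) (hv : Continuous v) (r : ℝ) :
    sphericalMean P κ q (fun x => u x + v x) r
      = sphericalMean P κ q u r + sphericalMean P κ q v r := by
  simp only [sphericalMean, sphereIntegral]
  rw [← mul_add, ← integral_add (integrable_sphere (continuous_sphericalMean_integrand hκ hu r))
    (integrable_sphere (continuous_sphericalMean_integrand hκ hv r))]
  simp only [mul_add, add_mul]

lemma sphericalMean_sum (hκ : ∀ α ∈ P, 0 ≤ κ α) {ι : Type*} (s : Finset ι)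
    {u : ι → EuclideanSpace ℝ (Fin d) → ℝ} (hu : ∀ i ∈ s, Continuous (u i)) (r : ℝ) :
    sphericalMean P κ q (fun x => ∑ i ∈ s, u i x) r = ∑ i ∈ s, sphericalMean P κ q (u i) r := by
  simp only [sphericalMean, sphereIntegral]
  rw [← Finset.mul_sum, ← integral_finsetSum s fun i hi =>
    integrable_sphere (continuous_sphericalMean_integrand hκ (hu i hi) r)]
  simp only [Finset.mul_sum, Finset.sum_mul]

lemma sphericalMean_congr {u v : EuclideanSpace ℝ (Fin d) → ℝ} (h : u =ᶠ[𝓝 0] v) :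
    ∀ᶠ r in 𝓝[>] (0 : ℝ), sphericalMean P κ q u r = sphericalMean P κ q v r := by
  obtain ⟨δ, hδ, hδu⟩ := Metric.eventually_nhds_iff.1 h
  filter_upwards [Ioo_mem_nhdsGT hδ] with r hr
  simp only [sphericalMean, sphereIntegral]
  congr 2
  ext y
  rw [hδu]
  rw [dist_zero_right, norm_smul, norm_eq_of_mem_sphere, mul_one, Real.norm_of_nonneg hr.1.le]
  exact hr.2

lemma sphericalMean_isBigO (hκ : ∀ α ∈ P, 0 ≤ κ α) {u : EuclideanSpace ℝ (Fin d) → ℝ} {k : ℕ}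
    (hu : u =O[𝓝 0] fun x => ‖x‖ ^ k) :
    (fun r => sphericalMean P κ q u r) =O[𝓝[>] (0 : ℝ)] fun r => r ^ k := by
  obtain ⟨C, hC⟩ := hu.bound
  obtain ⟨δ, hδ, hδu⟩ := Metric.eventually_nhds_iff.1 hC
  have hI := integrable_sphere
    (((contDiff_polyFun q).continuous.mul (continuous_weight_sq hκ)).abs.mul
      (continuous_const (y := C)))
  refine (IsBigO.const_mul_left (IsBigO.of_bound (∫ y : Metric.sphere
    (0 : EuclideanSpace ℝ (Fin d)) 1, |polyFun q y * weight P κ y ^ 2| * C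
      ∂(volume : Measure (EuclideanSpace ℝ (Fin d))).toSphere) ?_) _)
  filter_upwards [Ioo_mem_nhdsGT hδ] with r hr
  rw [← integral_mul_const]
  refine norm_integral_le_of_norm_le (hI.mul_const _) (Eventually.of_forall fun y => ?_)
  have hn : ‖r • (y : EuclideanSpace ℝ (Fin d))‖ = r := by
    rw [norm_smul, norm_eq_of_mem_sphere, mul_one, Real.norm_of_nonneg hr.1.le]
  have h1 := hδu (y := r • (y : EuclideanSpace ℝ (Fin d))) (by rw [dist_zero_right, hn]; exact hr.2)
  rw [hn] at h1
  calc ‖polyFun q y * u (r • (y : EuclideanSpace ℝ (Fin d))) * weight P κ y ^ 2‖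
      = |polyFun q y * weight P κ y ^ 2| * ‖u (r • (y : EuclideanSpace ℝ (Fin d)))‖ := by
        rw [← Real.norm_eq_abs, ← norm_mul, mul_right_comm]
    _ ≤ |polyFun q y * weight P κ y ^ 2| * (C * ‖r ^ k‖) :=
        mul_le_mul_of_nonneg_left h1 (abs_nonneg _)
    _ = _ := by ring

end SphericalMean

section Asymptotic

variable {d : ℕ} {R P : Finset (EuclideanSpace ℝ (Fin d))} {κ : EuclideanSpace ℝ (Fin d) → ℝ}
  {m : ℕ} {q : MvPolynomial (Fin d) ℝ}

/-- The asymptotic Pizzetti expansion of smooth functions. -/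
theorem pizzetti_isLittleO (hd : 0 < d) (hR : IsReducedRootSystem R) (hP : IsPositiveSystem R P)
    (hκ : IsMultiplicity R κ) (hq : IsHomogeneousHarmonic P κ m q)
    (f : EuclideanSpace ℝ (Fin d) → ℝ) (U : Set (EuclideanSpace ℝ (Fin d))) (hU : IsOpen U)
    (h0 : 0 ∈ U) (hf : ContDiffOn ℝ ∞ f U) (N : ℕ) :
    (fun r : ℝ => sphericalMean P κ q f r -
        ∑ n ∈ Finset.range (N + 1), pizzettiTerm P κ m q f r n)
      =o[𝓝[>] 0] (fun r : ℝ => r ^ (m + 2 * N)) := by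
  have hκ0 : ∀ α ∈ P, 0 ≤ κ α := fun α hα => hκ.nonneg α (hP.subset hα)
  have hP0 := hP.ne_zero hR
  obtain ⟨F, hF, hFf⟩ := exists_contDiff_eventuallyEq hU h0 hf
  obtain ⟨p, g, hp, hg, rfl⟩ := exists_taylor (m + 2 * N + 1) hF
  have hterm (n : ℕ) (hn : n ∈ Finset.range (N + 1)) (r : ℝ) : pizzettiTerm P κ m q f r n
      = ∑ k ∈ Finset.range (m + 2 * N + 1), pizzettiTerm P κ m q (polyFun (p k)) r n := by
    have hT := regularOp_dunklPoly_iterate (κ := κ) hP0 hq.1 n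
    have h1 := (hT.congr _ _ hFf).self_of_nhds
    have h2 : dunklPoly P κ q ((dunklLaplacian P κ)^[n] g) 0 = 0 := by
      have hn := Finset.mem_range.1 hn
      obtain ⟨a, ha⟩ : ∃ a, m + 2 * N + 1 = (a + 1) + (m + n * 2) :=
        ⟨2 * N - n * 2, by omega⟩
      exact (hT.flat (a + 1) g (ha ▸ hg)).apply_zero
    rw [hT.map_add _ _ (ContDiff.sum fun k _ => contDiff_polyFun (p k)) hg.contDiff,
      hT.map_sum _ fun k _ => contDiff_polyFun (p k)] at h1
    simp only [h2, add_zero] at h1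
    simp only [pizzettiTerm]
    rw [← h1, Finset.sum_div, Finset.sum_mul]
  have hmean : ∀ᶠ r in 𝓝[>] (0 : ℝ), sphericalMean P κ q g r = sphericalMean P κ q f r -
      ∑ n ∈ Finset.range (N + 1), pizzettiTerm P κ m q f r n := by
    filter_upwards [sphericalMean_congr (P := P) (κ := κ) (q := q) hFf] with r hr
    rw [← hr, sphericalMean_add hκ0
        (continuous_finsetSum _ fun k _ => (contDiff_polyFun (p k)).continuous)
        hg.contDiff.continuous,
      sphericalMean_sum hκ0 _ fun k _ => (contDiff_polyFun (p k)).continuous,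
      Finset.sum_congr rfl fun n hn => hterm n hn r, Finset.sum_comm,
      Finset.sum_congr rfl fun k hk => sphericalMean_eq_sum_pizzettiTerm hd hR hP hκ hq (hp k)
        (Nat.lt_succ_iff.1 (Finset.mem_range.1 hk)) r]
    ring
  refine IsLittleO.congr' ?_ hmean EventuallyEq.rfl
  refine (sphericalMean_isBigO hκ0 hg.isBigO).trans_isLittleO ?_
  exact (isLittleO_pow_pow (Nat.lt_succ_self _)).mono nhdsWithin_le_nhds

end Asymptotic

/-- Uniqueness of asymptotic expansions in powers of a small positive variable. -/
lemma eq_zero_of_sum_isLittleO {c : ℕ → ℝ}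
    (h : ∀ k, ∃ K, k ≤ K ∧ (fun r : ℝ => ∑ n ∈ Finset.range (K + 1), c n * r ^ n)
      =o[𝓝[>] (0 : ℝ)] fun r => r ^ K) (k : ℕ) : c k = 0 := by
  induction k using Nat.strong_induction_on with
  | _ k ih =>
    obtain ⟨K, hkK, hK⟩ := h k
    have h1 : (fun r : ℝ => r ^ K) =O[𝓝[>] (0 : ℝ)] fun r => r ^ k := by
      obtain ⟨j, rfl⟩ := Nat.exists_eq_add_of_le hkK
      have h2 : (fun r : ℝ => r ^ j) =O[𝓝[>] (0 : ℝ)] fun _ => (1 : ℝ) :=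
        (((continuous_pow j).tendsto (0 : ℝ)).mono_left nhdsWithin_le_nhds).isBigO_one ℝ
      simpa only [pow_add, mul_one] using (isBigO_refl (fun r : ℝ => r ^ k) _).mul h2
    have h2 : (fun r : ℝ => ∑ n ∈ Finset.range (K + 1), c n * r ^ n - c k * r ^ k)
        =o[𝓝[>] (0 : ℝ)] fun r => r ^ k := by
      have h3 : (fun r : ℝ => ∑ n ∈ Finset.range (K + 1), c n * r ^ n - c k * r ^ k)
          = fun r => ∑ n ∈ (Finset.range (K + 1)).erase k, c n * r ^ n := by
        ext r
        rw [← Finset.add_sum_erase _ _ (Finset.mem_range.2 (Nat.lt_succ_of_le hkK)),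
          add_sub_cancel_left]
      rw [h3]
      refine IsLittleO.fun_sum fun n hn => ?_
      rcases lt_or_gt_of_ne (Finset.ne_of_mem_erase hn) with hlt | hgt
      · simp only [ih n hlt, zero_mul]
        exact isLittleO_zero _ _
      · exact ((isLittleO_pow_pow hgt).mono nhdsWithin_le_nhds).const_mul_left _
    have h3 : (fun r : ℝ => c k * r ^ k) =o[𝓝[>] (0 : ℝ)] fun r => r ^ k := by
      simpa using (hK.trans_isBigO h1).sub h2
    by_contra hc
    have h4 : (fun r : ℝ => r ^ k) =o[𝓝[>] (0 : ℝ)] fun r => r ^ k :=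
      (isLittleO_const_mul_left_iff hc).1 h3
    refine isLittleO_irrefl (Eventually.frequently ?_) h4
    filter_upwards [self_mem_nhdsWithin] with r hr
    exact (pow_pos (Set.mem_Ioi.1 hr) k).ne'

section Analytic

variable {d : ℕ} {R P : Finset (EuclideanSpace ℝ (Fin d))} {κ : EuclideanSpace ℝ (Fin d) → ℝ}
  {m : ℕ} {q : MvPolynomial (Fin d) ℝ}

lemma sphericalMean_of_smul {u : EuclideanSpace ℝ (Fin d) → ℝ} {k : ℕ}
    (hu : ∀ (r : ℝ) x, u (r • x) = r ^ k * u x) (r : ℝ) :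
    sphericalMean P κ q u r = sphericalMean P κ q u 1 * r ^ k := by
  simp only [sphericalMean, sphereIntegral]
  rw [mul_assoc, ← integral_mul_const]
  congr 2
  ext y
  rw [hu, one_smul]
  ring

/-- The spherical mean of a convergent power series is the series of the spherical means. -/
lemma hasSum_sphericalMean (hκ : ∀ α ∈ P, 0 ≤ κ α) {f : EuclideanSpace ℝ (Fin d) → ℝ}
    {p : FormalMultilinearSeries ℝ (EuclideanSpace ℝ (Fin d)) ℝ} {ρ : ENNReal}
    (hf : HasFPowerSeriesOnBall f p 0 ρ) {r : NNReal} (hr : r < ρ) :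
    HasSum (fun n => sphericalMean P κ q (fun x => p n fun _ => x) r)
      (sphericalMean P κ q f r) := by
  have hpc (n : ℕ) : Continuous fun x => p n fun _ => x :=
    (p n).cont.comp (continuous_pi fun _ => continuous_id)
  set μ := (volume : Measure (EuclideanSpace ℝ (Fin d))).toSphere
  set F : ℕ → Metric.sphere (0 : EuclideanSpace ℝ (Fin d)) 1 → ℝ := fun n y =>
    polyFun q y * p n (fun _ => (r : ℝ) • (y : EuclideanSpace ℝ (Fin d))) * weight P κ y ^ 2
  have hI (n : ℕ) : Integrable (F n) μ :=
    integrable_sphere (continuous_sphericalMean_integrand hκ (hpc n) r)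
  have hB : Integrable (fun y : Metric.sphere (0 : EuclideanSpace ℝ (Fin d)) 1 =>
      |polyFun q y * weight P κ y ^ 2|) μ :=
    integrable_sphere ((contDiff_polyFun q).continuous.mul (continuous_weight_sq hκ)).abs
  have hle (n : ℕ) (y : Metric.sphere (0 : EuclideanSpace ℝ (Fin d)) 1) :
      ‖F n y‖ ≤ |polyFun q y * weight P κ y ^ 2| * (‖p n‖ * (r : ℝ) ^ n) := by
    have h1 : ‖p n (fun _ => (r : ℝ) • (y : EuclideanSpace ℝ (Fin d)))‖ ≤ ‖p n‖ * (r : ℝ) ^ n := by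
      refine ((p n).le_opNorm _).trans_eq ?_
      rw [Finset.prod_const, norm_smul, norm_eq_of_mem_sphere, mul_one,
        Real.norm_of_nonneg r.coe_nonneg, Finset.card_univ, Fintype.card_fin]
    calc ‖F n y‖ = |polyFun q y * weight P κ y ^ 2| *
          ‖p n (fun _ => (r : ℝ) • (y : EuclideanSpace ℝ (Fin d)))‖ := by
          rw [← Real.norm_eq_abs, ← norm_mul, mul_right_comm]
      _ ≤ _ := mul_le_mul_of_nonneg_left h1 (abs_nonneg _)
  have hS : Summable fun n => ∫ y, ‖F n y‖ ∂μ := by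
    refine Summable.of_nonneg_of_le (fun n => integral_nonneg fun y => norm_nonneg _) (fun n => ?_)
      ((p.summable_norm_mul_pow (hr.trans_le hf.r_le)).mul_left
        (∫ y : Metric.sphere (0 : EuclideanSpace ℝ (Fin d)) 1,
          |polyFun q y * weight P κ y ^ 2| ∂μ))
    rw [← integral_mul_const]
    exact integral_mono (hI n).norm (hB.mul_const _) (hle n)
  have h1 := (hasSum_integral_of_summable_integral_norm hI hS).mul_left (1 / omega P κ)
  have h2 (y : Metric.sphere (0 : EuclideanSpace ℝ (Fin d)) 1) : ∑' n, F n y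
      = polyFun q y * f ((r : ℝ) • (y : EuclideanSpace ℝ (Fin d))) * weight P κ y ^ 2 := by
    have hy : (r : ℝ) • (y : EuclideanSpace ℝ (Fin d)) ∈ Metric.eball 0 ρ := by
      rw [Metric.mem_eball, edist_zero_right, enorm_smul, ← ofReal_norm, ← ofReal_norm,
        norm_eq_of_mem_sphere, ENNReal.ofReal_one, mul_one, Real.norm_of_nonneg r.coe_nonneg,
        ENNReal.ofReal_coe_nnreal]
      exact hr
    have h3 := hf.hasSum hy
    rw [zero_add] at h3
    exact ((h3.mul_left (polyFun q y)).mul_right (weight P κ y ^ 2)).tsum_eq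
  simp only [h2] at h1
  exact h1

/-- The Pizzetti series of analytic functions. -/
theorem pizzetti_hasSum (hd : 0 < d) (hR : IsReducedRootSystem R) (hP : IsPositiveSystem R P)
    (hκ : IsMultiplicity R κ) (hq : IsHomogeneousHarmonic P κ m q)
    (f : EuclideanSpace ℝ (Fin d) → ℝ) (hf : AnalyticOnNhd ℝ f (Metric.ball 0 1)) :
    ∃ ρ ∈ Set.Ioo (0 : ℝ) 1, ∀ r : ℝ, 0 < r → r < ρ →
      HasSum (pizzettiTerm P κ m q f r) (sphericalMean P κ q f r) := by
  have hκ0 : ∀ α ∈ P, 0 ≤ κ α := fun α hα => hκ.nonneg α (hP.subset hα)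
  have h0 : (0 : EuclideanSpace ℝ (Fin d)) ∈ Metric.ball 0 1 := Metric.mem_ball_self one_pos
  have hfs : ContDiffOn ℝ ∞ f (Metric.ball 0 1) := hf.contDiffOn Metric.isOpen_ball.uniqueDiffOn
  obtain ⟨p, ρ, hp⟩ := hf 0 h0
  have hpc (n : ℕ) : Continuous fun x => p n fun _ => x :=
    (p n).cont.comp (continuous_pi fun _ => continuous_id)
  have hhom (n : ℕ) (r : ℝ) (x : EuclideanSpace ℝ (Fin d)) :
      p n (fun _ => r • x) = r ^ n * p n fun _ => x := by
    have := (p n).map_smul_univ (fun _ => r) (fun _ => x)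
    simpa using this
  set A : ℕ → ℝ := fun n => sphericalMean P κ q (fun x => p n fun _ => x) 1 with hA
  have hAr (n : ℕ) (r : ℝ) : sphericalMean P κ q (fun x => p n fun _ => x) r = A n * r ^ n :=
    sphericalMean_of_smul (hhom n) r
  set B : ℕ → ℝ := fun n => dunklPoly P κ q ((dunklLaplacian P κ)^[n] f) 0 /
    ((n.factorial : ℝ) * (ascPochhammer ℝ (m + n)).eval (lam P κ + 1)) / 2 ^ (m + 2 * n) with hB
  have hBr (n : ℕ) (r : ℝ) : pizzettiTerm P κ m q f r n = B n * r ^ (m + 2 * n) := by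
    rw [pizzettiTerm, hB, div_pow]
    ring
  have hι : Function.Injective fun n : ℕ => m + 2 * n := fun a b h => by
    simp only at h
    omega
  set b : ℕ → ℝ := Function.extend (fun n : ℕ => m + 2 * n) B 0 with hb
  have hbB (n : ℕ) : b (m + 2 * n) = B n := hι.extend_apply B 0 n
  have hb0 (k : ℕ) (hk : ∀ n, m + 2 * n ≠ k) : b k = 0 :=
    Function.extend_apply' _ _ _ fun ⟨n, hn⟩ => hk n hn
  have hsum (N : ℕ) (r : ℝ) : ∑ k ∈ Finset.range (m + 2 * N + 1), b k * r ^ k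
      = ∑ n ∈ Finset.range (N + 1), pizzettiTerm P κ m q f r n := by
    rw [Finset.sum_congr rfl fun n _ => hBr n r]
    symm
    have h1 : ∑ n ∈ Finset.range (N + 1), B n * r ^ (m + 2 * n)
        = ∑ k ∈ (Finset.range (N + 1)).map ⟨_, hι⟩, b k * r ^ k := by
      rw [Finset.sum_map]
      exact Finset.sum_congr rfl fun n _ => by rw [Function.Embedding.coeFn_mk, hbB]
    rw [h1]
    refine Finset.sum_subset (fun k hk => ?_) fun k hk hk' => ?_
    · obtain ⟨n, hn, rfl⟩ := Finset.mem_map.1 hk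
      have := Finset.mem_range.1 hn
      rw [Finset.mem_range, Function.Embedding.coeFn_mk]
      omega
    · rw [hb0 k fun n hn => hk' ?_, zero_mul]
      refine Finset.mem_map.2 ⟨n, ?_, hn⟩
      have := Finset.mem_range.1 hk
      rw [Finset.mem_range]
      omega
  obtain ⟨F, hF, hFf⟩ := exists_contDiff_eventuallyEq Metric.isOpen_ball h0 hfs
  have hnc (n : ℕ) : Continuous fun x => (-1 : ℝ) * p n fun _ => x := continuous_const.mul (hpc n)
  have hO (K : ℕ) : (fun r => sphericalMean P κ q f r - ∑ n ∈ Finset.range (K + 1), A n * r ^ n)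
      =O[𝓝[>] (0 : ℝ)] fun r => r ^ (K + 1) := by
    have h1 := hp.hasFPowerSeriesAt.isBigO_sub_partialSum_pow (K + 1)
    simp only [zero_add] at h1
    have h2 : (fun x => F x + ∑ n ∈ Finset.range (K + 1), -1 * p n fun _ => x)
        =O[𝓝 0] fun x => ‖x‖ ^ (K + 1) := by
      refine IsBigO.congr' h1 ?_ EventuallyEq.rfl
      filter_upwards [hFf] with x hx
      rw [hx, FormalMultilinearSeries.partialSum, ← Finset.mul_sum]
      ring
    refine IsBigO.congr' (sphericalMean_isBigO (P := P) (κ := κ) (q := q) hκ0 h2) ?_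
      EventuallyEq.rfl
    filter_upwards [sphericalMean_congr (P := P) (κ := κ) (q := q) hFf] with r hr
    rw [sphericalMean_add hκ0 hF.continuous (continuous_finsetSum _ fun n _ => hnc n), hr,
      sphericalMean_sum hκ0 _ fun n _ => hnc n, sub_eq_add_neg, ← Finset.sum_neg_distrib]
    congr 1
    refine Finset.sum_congr rfl fun n _ => ?_
    rw [← hAr]
    simp only [sphericalMean, sphereIntegral]
    rw [← mul_neg, ← integral_neg]
    congr 2
    ext y
    ring
  have hAb (k : ℕ) : A k = b k := by
    refine sub_eq_zero.1 (eq_zero_of_sum_isLittleO (c := fun k => A k - b k) (fun k => ?_) k)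
    refine ⟨m + 2 * k, by omega, ?_⟩
    have h1 := pizzetti_isLittleO hd hR hP hκ hq f _ Metric.isOpen_ball h0 hfs k
    have h2 := (hO (m + 2 * k)).trans_isLittleO
      ((isLittleO_pow_pow (Nat.lt_succ_self _)).mono nhdsWithin_le_nhds)
    refine (h1.sub h2).congr_left fun r => ?_
    rw [← hsum k r, sub_sub_sub_cancel_left, ← Finset.sum_sub_distrib]
    exact Finset.sum_congr rfl fun n _ => by ring
  obtain ⟨ρ', hρ', hρρ⟩ := ENNReal.lt_iff_exists_nnreal_btwn.1 hp.r_pos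
  have hρ'0 : 0 < (ρ' : ℝ) := NNReal.coe_pos.2 (ENNReal.coe_pos.1 hρ')
  refine ⟨min ρ' (1 / 2), ⟨lt_min hρ'0 one_half_pos,
    (min_le_right _ _).trans_lt one_half_lt_one⟩, fun r hr0 hr => ?_⟩
  lift r to NNReal using hr0.le
  have hlt : (r : ENNReal) < ρ :=
    (ENNReal.coe_lt_coe.2 (NNReal.coe_lt_coe.1 (hr.trans_le (min_le_left _ _)))).trans hρρ
  have h1 := hasSum_sphericalMean (P := P) (κ := κ) (q := q) hκ0 hp hlt
  simp only [hAr, hAb] at h1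
  rw [← hι.hasSum_iff fun k hk => by
    rw [hb0 k fun n hn => hk ⟨n, hn⟩, zero_mul]] at h1
  convert h1 using 1
  ext n
  rw [Function.comp_apply, hbB, hBr]

end Analytic

end

end Dunkl

theorem theorem3p2 {d : ℕ} (hd : 0 < d)
    (R P : Finset (EuclideanSpace ℝ (Fin d))) (κ : EuclideanSpace ℝ (Fin d) → ℝ)
    (hR : Dunkl.IsReducedRootSystem R) (hP : Dunkl.IsPositiveSystem R P)
    (hκ : Dunkl.IsMultiplicity R κ)
    (m : ℕ) (q : MvPolynomial (Fin d) ℝ) (hq : Dunkl.IsHomogeneousHarmonic P κ m q) :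
    (∀ (f : EuclideanSpace ℝ (Fin d) → ℝ) (U : Set (EuclideanSpace ℝ (Fin d))),
      IsOpen U → 0 ∈ U → ContDiffOn ℝ ∞ f U → ∀ N : ℕ,
        (fun r : ℝ => Dunkl.sphericalMean P κ q f r -
            ∑ n ∈ Finset.range (N + 1), Dunkl.pizzettiTerm P κ m q f r n)
          =o[𝓝[>] 0] (fun r : ℝ => r ^ (m + 2 * N))) ∧
    (∀ f : EuclideanSpace ℝ (Fin d) → ℝ,
      AnalyticOnNhd ℝ f (Metric.ball 0 1) →
        ∃ ρ ∈ Set.Ioo (0 : ℝ) 1, ∀ r : ℝ, 0 < r → r < ρ →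
          HasSum (Dunkl.pizzettiTerm P κ m q f r) (Dunkl.sphericalMean P κ q f r)) :=
  ⟨fun f U hU h0 hf N => Dunkl.pizzetti_isLittleO hd hR hP hκ hq f U hU h0 hf N,
    fun f hf => Dunkl.pizzetti_hasSum hd hR hP hκ hq f hf⟩
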